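/- Let $\mathcal G_{3\times n}$ be the $3\times n$ grid graph, with vertex set $\{a_i,b_i,c_i : 1\le i\le n\}$ and edges $\{a_i,a_{i+1}\},\{b_i,b_{i+1}\},\{c_i,c_{i+1}\}$ for $1\le i\le n-1$ and $\{a_j,b_j\},\{b_j,c_j\}$ for $1\le j\le n$. For a finite simple graph $G$, the total $k$-cut complex $\Delta_k^t(G)$ is the simplicial complex on the vertices of $G$ whose faces are the sets $\sigma\subseteq V(G)$ such that the complement $V(G)\setminus\sigma$ contains an independent set of $G$ of size $k$. **Theorem.** For every $n\ge 2$, (the geometric realization of) the total $3$-cut complex of $\mathcal G_{3\times n}$ is homotopy equivalent to a wedge of $\binom{2n-2}{2}$ spheres of dimension $3n-6$: $$\Delta_3^t(\mathcal G_{3\times n})\;\simeq\;\bigvee_{\binom{2n-2}{2}}\mathbb S^{3n-6}.$$ -/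

import Mathlib

/-- The `m × n` grid graph: the Cartesian (box) product of the paths on `m` and `n` vertices.
For `m = 3` the vertices `(0, i)`, `(1, i)`, `(2, i)` are `a_{i+1}`, `b_{i+1}`, `c_{i+1}`. -/
def gridGraph (m n : ℕ) : SimpleGraph (Fin m × Fin n) :=
  (SimpleGraph.pathGraph m).boxProd (SimpleGraph.pathGraph n)

/-- The total `k`-cut complex of a graph: a (nonempty) set of vertices is a face iff its complement
contains an independent set of size `k`. As usual in Mathlib, the empty simplex is not listed
among the faces; this does not affect the geometric realization. -/
def totalCutComplex {V : Type*} (G : SimpleGraph V) (k : ℕ) : PreAbstractSimplicialComplex V where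
  faces := {σ | σ.Nonempty ∧ ∃ s : Finset V, G.IsNIndepSet k s ∧ (s : Set V) ⊆ (σ : Set V)ᶜ}
  isRelLowerSet_faces := by
    rintro σ ⟨hσ, s, hs, hsσ⟩
    refine ⟨hσ, fun τ hτ hne => ⟨hne, s, hs, hsσ.trans ?_⟩⟩
    exact Set.compl_subset_compl.mpr (Finset.coe_subset.mpr hτ)

/-- The geometric realization of a simplicial complex on a finite vertex set, with its barycentric
coordinates: the points of the standard simplex on `V` that are supported on a face,
with the subspace topology of `V → ℝ`. -/
def geometricRealization {V : Type*} [Fintype V] (K : PreAbstractSimplicialComplex V) :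
    Set (V → ℝ) :=
  {x | x ∈ stdSimplex ℝ V ∧ ∃ σ ∈ K.faces, ∀ v, v ∉ σ → x v = 0}

/-- A point of `Unit ⊕ Σ i, X i` is a base point if it is the extra point
or one of the chosen base points `x₀ i`. -/
def IsWedgeBase {ι : Type*} {X : ι → Type*} (x₀ : ∀ i, X i) : Unit ⊕ (Σ i, X i) → Prop
  | Sum.inl _ => True
  | Sum.inr p => p.2 = x₀ p.1

/-- The equivalence relation on `Unit ⊕ Σ i, X i` that identifies all base points. -/
def wedgeSetoid {ι : Type*} {X : ι → Type*} (x₀ : ∀ i, X i) : Setoid (Unit ⊕ (Σ i, X i)) where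
  r p q := p = q ∨ (IsWedgeBase x₀ p ∧ IsWedgeBase x₀ q)
  iseqv :=
    { refl := fun _ => Or.inl rfl
      symm := by
        rintro p q (h | ⟨h₁, h₂⟩)
        · exact Or.inl h.symm
        · exact Or.inr ⟨h₂, h₁⟩
      trans := by
        rintro p q r (rfl | ⟨h₁, h₂⟩) (rfl | ⟨h₃, h₄⟩)
        · exact Or.inl rfl
        · exact Or.inr ⟨h₃, h₄⟩
        · exact Or.inr ⟨h₁, h₂⟩
        · exact Or.inr ⟨h₁, h₄⟩ }

/-- The wedge of a family of pointed spaces: the disjoint union with all base points identified,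
with the quotient topology. Thanks to the extra point the empty wedge is a single point. -/
abbrev Wedge {ι : Type*} {X : ι → Type*} [∀ i, TopologicalSpace (X i)] (x₀ : ∀ i, X i) : Type _ :=
  Quotient (wedgeSetoid x₀)

/-- The unit sphere `S^d` in `ℝ^(d+1)`. -/
abbrev UnitSphere (d : ℕ) : Type :=
  Metric.sphere (0 : EuclideanSpace ℝ (Fin (d + 1))) 1

/-- The base point `(1, 0, …, 0)` of `S^d`. -/
noncomputable def UnitSphere.base (d : ℕ) : UnitSphere d :=
  ⟨EuclideanSpace.single 0 1, by simp⟩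

/-- The wedge of `r` spheres of dimension `d`. -/
abbrev WedgeOfSpheres (r d : ℕ) : Type :=
  Wedge (fun _ : Fin r => UnitSphere.base d)

/-!
A face of the complex is recorded by its complement. A set `τ` of vertices not containing the corner
`v₀` of the grid is *off the star* if the complement of `insert v₀ τ` is a face outside the star of
`v₀`; that is, `insert v₀ τ` contains an independent triple and `τ` does not. Any five vertices
contain an independent triple, because the grid is bipartite, so such a `τ` has at most four
elements.

These sets are matched in pairs `τ`, `insert p τ` (`Toggles`). The rule looks at the last column met
by `τ`. If `τ` has one vertex there, or its two ends, its left neighbour may be toggled; if `τ`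
contains an edge of that column, the rest of `τ` is a clique, and the vertices further left are
matched along a spanning tree. Ordering pairs by size and then by the positions of the vertices, one
sees that the matching is acyclic (`OffStar.gridIndex_lt`), so the matched faces can be removed by
collapses (`nonempty_homotopyEquiv_of_matching`). The critical sets are a full column `j ≥ 1`
(counting from `0`) with one vertex of the column before it, and the unions of two column edges from
distinct columns `≥ 1`. With `m = n - 1` there are `m + 4 * m.choose 2 = (2 * m).choose 2` of them,
all of size four (`IsCritical.eq_fullColumn_or`, `card_criticalSets`).

What remains is the star of `v₀`, a cone, and one face of dimension `3 * n - 6` for each critical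
set, whose boundary lies in the star since sets of five vertices contain independent triples. The
cone is contracted to `v₀` by a homotopy that extends over the attached simplices, so dividing it
out does not change the homotopy type (`nonempty_homotopyEquiv_of_isQuotientMap`). The quotient is a
wedge of simplices modulo their boundaries, and `simplexToSphere` identifies each with a sphere
(`nonempty_homotopyEquiv_wedgeOfSpheres`).
-/

section Topology

open Topology unitInterval

/-! ### Collapsing a contractible subspace -/

/-- If a homotopy of `X` starts at the identity, preserves `C` and contracts `C` to a point,
then a quotient map whose only nontrivial fibre is `C` is a homotopy equivalence. -/
theorem nonempty_homotopyEquiv_of_isQuotientMap {X W : Type*} [TopologicalSpace X]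
    [TopologicalSpace W] (f : C(X, W)) (hf : IsQuotientMap f) (C : Set X) (a : X)
    (H : C(I × X, X)) (h0 : ∀ x, H (0, x) = x) (hC : ∀ t, ∀ x ∈ C, H (t, x) ∈ C)
    (h1 : ∀ x ∈ C, H (1, x) = a) (hfC : ∀ x ∈ C, ∀ y ∈ C, f x = f y)
    (hfi : ∀ x y, f x = f y → x = y ∨ x ∈ C ∧ y ∈ C) :
    Nonempty (ContinuousMap.HomotopyEquiv X W) := by
  let H1 : C(X, X) := ⟨fun x => H (1, x), by fun_prop⟩
  have hH1 : Function.FactorsThrough H1 f := by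
    intro x y hxy
    rcases hfi x y hxy with rfl | ⟨hx, hy⟩
    · rfl
    · change H (1, x) = H (1, y)
      rw [h1 x hx, h1 y hy]
  let g : C(W, X) := hf.lift H1 hH1
  have hg : ∀ x, g (f x) = H (1, x) := fun x =>
    DFunLike.congr_fun (hf.lift_comp H1 hH1) x
  -- The homotopy descends to `W`: it is lifted along `f` as a map into the space of paths in `W`,
  -- so that no product of quotient maps is needed.
  let Φ : C(X, C(I, W)) :=
    ContinuousMap.curry ⟨fun p : X × I => f (H (p.2, p.1)), by fun_prop⟩
  have hΦ : Function.FactorsThrough Φ f := by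
    intro x y hxy
    rcases hfi x y hxy with rfl | ⟨hx, hy⟩
    · rfl
    · ext t
      exact hfC _ (hC t x hx) _ (hC t y hy)
  let Ψ : C(W, C(I, W)) := hf.lift Φ hΦ
  have hΨ : ∀ x t, Ψ (f x) t = f (H (t, x)) := fun x t => by
    have := DFunLike.congr_fun (hf.lift_comp Φ hΦ) x
    exact DFunLike.congr_fun this t
  refine ⟨⟨f, g, ContinuousMap.Homotopic.symm ⟨⟨H, h0, fun x => (hg x).symm⟩⟩,
    ContinuousMap.Homotopic.symm ⟨⟨⟨fun p => Ψ p.2 p.1, by fun_prop⟩, ?_, ?_⟩⟩⟩⟩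
  · intro w
    obtain ⟨x, rfl⟩ := hf.surjective w
    change Ψ (f x) 0 = f x
    rw [hΨ, h0]
  · intro w
    obtain ⟨x, rfl⟩ := hf.surjective w
    change Ψ (f x) 1 = f (g (f x))
    rw [hΨ, hg]

theorem wedge_mk_eq_iff {ι : Type*} {X : ι → Type*} [∀ i, TopologicalSpace (X i)]
    (x₀ : ∀ i, X i) (p q : Unit ⊕ (Σ i, X i)) :
    (Quotient.mk (wedgeSetoid x₀) p : Wedge x₀) = Quotient.mk (wedgeSetoid x₀) q ↔
      p = q ∨ (IsWedgeBase x₀ p ∧ IsWedgeBase x₀ q) :=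
  Quotient.eq

/-- Let `X` be the union of a closed set `C` and finitely many cells `ε i : D → X`, each meeting `C`
exactly in the part of `D` that `q : D → S` sends to the base point, with otherwise disjoint images.
If a homotopy of `X` contracts `C` within itself, then `X` is a wedge of copies of `S`. -/
theorem nonempty_homotopyEquiv_wedge {ι X D S : Type*} [Finite ι] [TopologicalSpace X] [T2Space X]
    [TopologicalSpace D] [CompactSpace D] [TopologicalSpace S] [T2Space S]
    (C : Set X) (hCc : IsClosed C) (a : X) (ha : a ∈ C) (s₀ : S) (q : D → S) (hq : Continuous q)
    (hqs : ∀ s, s ≠ s₀ → ∃ y, q y = s) (hqi : ∀ x y, q x = q y → q x ≠ s₀ → x = y)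
    (ε : ι → D → X) (hε : ∀ i, Continuous (ε i)) (hεC : ∀ i y, ε i y ∈ C ↔ q y = s₀)
    (hεi : ∀ i j y z, ε i y = ε j z → ε i y ∉ C → i = j ∧ y = z)
    (hcov : ∀ x, x ∈ C ∨ ∃ i y, ε i y = x)
    (H : C(I × X, X)) (h0 : ∀ x, H (0, x) = x) (hC : ∀ t, ∀ x ∈ C, H (t, x) ∈ C)
    (h1 : ∀ x ∈ C, H (1, x) = a) :
    Nonempty (ContinuousMap.HomotopyEquiv X (Wedge (fun _ : ι => s₀))) := by
  classical
  let W := Wedge (fun _ : ι => s₀)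
  let π : Unit ⊕ (Σ _ : ι, S) → W := Quotient.mk _
  have hπ : ∀ p p', π p = π p' ↔ p = p' ∨
      (IsWedgeBase (fun _ : ι => s₀) p ∧ IsWedgeBase (fun _ : ι => s₀) p') :=
    wedge_mk_eq_iff (fun _ : ι => s₀)
  have hex : ∀ x, ∃ w : W, (x ∈ C → w = π (Sum.inl ())) ∧
      ∀ i y, ε i y = x → w = π (Sum.inr ⟨i, q y⟩) := by
    intro x
    by_cases hx : x ∈ C
    · refine ⟨π (Sum.inl ()), fun _ => rfl, ?_⟩
      rintro i y rfl
      exact (hπ _ _).2 (Or.inr ⟨trivial, (hεC i y).1 hx⟩)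
    · obtain ⟨i, y, hy⟩ := (hcov x).resolve_left hx
      refine ⟨π (Sum.inr ⟨i, q y⟩), fun h => absurd h hx, ?_⟩
      intro j z hz
      obtain ⟨rfl, rfl⟩ := hεi i j y z (hy.trans hz.symm) (hy ▸ hx)
      rfl
  choose f hfC hfε using hex
  have hfε' : ∀ i y, f (ε i y) = π (Sum.inr ⟨i, q y⟩) := fun i y => hfε _ i y rfl
  have hfc : Continuous f := by
    rw [continuous_iff_isClosed]
    intro Z hZ
    have hπc : Continuous π := continuous_quotient_mk'
    have key : f ⁻¹' Z = (C ∩ {_x | π (Sum.inl ()) ∈ Z}) ∪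
        ⋃ i, ε i '' {y | π (Sum.inr ⟨i, q y⟩) ∈ Z} := by
      ext x
      simp only [Set.mem_preimage, Set.mem_union, Set.mem_inter_iff, Set.mem_ofPred_eq,
        Set.mem_iUnion, Set.mem_image]
      constructor
      · intro hx
        rcases hcov x with h | ⟨i, y, rfl⟩
        · exact Or.inl ⟨h, hfC x h ▸ hx⟩
        · exact Or.inr ⟨i, y, hfε' i y ▸ hx, rfl⟩
      · rintro (⟨h, hz⟩ | ⟨i, y, hz, rfl⟩)
        · rwa [hfC x h]
        · rwa [hfε']
    rw [key]
    refine (hCc.inter isClosed_const).union (isClosed_iUnion_of_finite fun i => ?_)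
    refine (IsClosed.isCompact ?_).image (hε i) |>.isClosed
    have : Continuous fun y : D => π (Sum.inr ⟨i, q y⟩) :=
      hπc.comp (continuous_inr.comp (continuous_sigmaMk.comp hq))
    exact hZ.preimage this
  have hfs : Function.Surjective f := by
    intro w
    obtain ⟨p, rfl⟩ := Quotient.exists_rep w
    rcases p with ⟨⟩ | ⟨i, s⟩
    · exact ⟨a, hfC a ha⟩
    · by_cases hs : s = s₀
      · exact ⟨a, (hfC a ha).trans ((hπ _ _).2 (Or.inr ⟨trivial, hs⟩))⟩
      · obtain ⟨y, rfl⟩ := hqs s hs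
        exact ⟨ε i y, hfε' i y⟩
  have hfq : IsQuotientMap f := by
    refine ⟨IsCoinducing.of_isClosed_preimage_iff_isClosed fun Z =>
      ⟨fun hZ => ?_, fun h => h.preimage hfc⟩, hfs⟩
    have hπq : IsQuotientMap π := isQuotientMap_quotient_mk'
    rw [← hπq.isClosed_preimage, isClosed_sum_iff]
    refine ⟨isClosed_discrete _, ?_⟩
    rw [isClosed_sigma_iff]
    intro i
    -- The base point is adjoined because `q` need not attain it.
    have : Sigma.mk i ⁻¹' (Sum.inr ⁻¹' (π ⁻¹' Z)) =
        q '' (ε i ⁻¹' (f ⁻¹' Z)) ∪ {s | s = s₀ ∧ π (Sum.inr ⟨i, s₀⟩) ∈ Z} := by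
      ext s
      simp only [Set.mem_preimage, Set.mem_union, Set.mem_image, Set.mem_ofPred_eq, hfε']
      constructor
      · intro h
        by_cases hs : s = s₀
        · subst hs
          exact Or.inr ⟨rfl, h⟩
        · obtain ⟨y, rfl⟩ := hqs s hs
          exact Or.inl ⟨y, h, rfl⟩
      · rintro (⟨y, h, rfl⟩ | ⟨rfl, h⟩) <;> exact h
    rw [this]
    refine IsClosed.union ?_ ?_
    · exact ((hZ.preimage (hε i)).isCompact.image hq).isClosed
    · exact (Set.Subsingleton.finite fun x hx y hy => hx.1.trans hy.1.symm).isClosed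
  refine nonempty_homotopyEquiv_of_isQuotientMap ⟨f, hfc⟩ hfq C a H h0 hC h1 ?_ ?_
  · intro x hx y hy
    exact (hfC x hx).trans (hfC y hy).symm
  · -- Off `C` the quotient map is injective, and it sends no point off `C` to the base point.
    have hoff : ∀ x, x ∉ C → ∀ y, f x = f y → x = y := by
      intro x hx y hxy
      obtain ⟨i, u, rfl⟩ := (hcov x).resolve_left hx
      have hu : q u ≠ s₀ := fun h => hx ((hεC i u).2 h)
      rcases hcov y with hy | ⟨j, v, rfl⟩
      · rw [hfε', hfC y hy, hπ] at hxy
        rcases hxy with h | ⟨h, -⟩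
        · cases h
        · exact absurd h hu
      · rw [hfε', hfε', hπ] at hxy
        rcases hxy with h | ⟨h, -⟩
        · rw [Sum.inr.injEq, Sigma.mk.injEq] at h
          obtain ⟨rfl, h⟩ := h
          rw [hqi u v (eq_of_heq h) hu]
        · exact absurd h hu
    intro x y hxy
    by_cases hx : x ∈ C
    · by_cases hy : y ∈ C
      · exact Or.inr ⟨hx, hy⟩
      · exact Or.inl (hoff y hy x hxy.symm).symm
    · exact Or.inl (hoff x hx y hxy)

/-! ### The simplex modulo its boundary is a sphere -/

/-- The smallest barycentric coordinate of a point of the standard `d`-simplex. -/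
noncomputable def simplexMin {d : ℕ} (x : Fin (d + 1) → ℝ) : ℝ :=
  Finset.univ.inf' Finset.univ_nonempty x

theorem continuous_simplexMin {d : ℕ} : Continuous (simplexMin (d := d)) := by
  unfold simplexMin
  exact Continuous.finset_inf'_apply _ fun i _ => continuous_apply i

theorem simplexMin_le {d : ℕ} (x : Fin (d + 1) → ℝ) (i : Fin (d + 1)) : simplexMin x ≤ x i :=
  Finset.inf'_le _ (Finset.mem_univ i)

theorem exists_simplexMin_eq {d : ℕ} (x : Fin (d + 1) → ℝ) : ∃ i, simplexMin x = x i := by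
  obtain ⟨i, -, hi⟩ := Finset.exists_mem_eq_inf' Finset.univ_nonempty x
  exact ⟨i, hi⟩

theorem simplexMin_affine {d : ℕ} (x : Fin (d + 1) → ℝ) (a b : ℝ) (ha : 0 ≤ a) :
    simplexMin (fun i => b + a * x i) = b + a * simplexMin x := by
  refine le_antisymm ?_ ?_
  · obtain ⟨i, hi⟩ := exists_simplexMin_eq x
    rw [hi]
    exact simplexMin_le (fun i => b + a * x i) i
  · obtain ⟨i, hi⟩ := exists_simplexMin_eq (fun i => b + a * x i)
    rw [hi]
    have := mul_le_mul_of_nonneg_left (simplexMin_le x i) ha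
    linarith

/-- The smallest barycentric coordinate, scaled to be `1` at the barycentre; it is `0` on the
boundary. -/
noncomputable def simplexHeight {d : ℕ} (x : Fin (d + 1) → ℝ) : ℝ :=
  (d + 1) * simplexMin x

/-- The sum of the squares of the barycentric coordinates other than the `0`-th, taken relative to
the barycentre. -/
noncomputable def simplexNormSq {d : ℕ} (x : Fin (d + 1) → ℝ) : ℝ :=
  ∑ j : Fin d, (x j.succ - 1 / (d + 1)) ^ 2

/-- A point of the simplex cannot be the barycentre and lie on the boundary. -/
theorem simplexNormSq_add_pos {d : ℕ} (x : Fin (d + 1) → ℝ) (hx : x ∈ stdSimplex ℝ (Fin (d + 1))) :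
    0 < simplexNormSq x + simplexHeight x ^ 2 := by
  have h1 : 0 ≤ simplexNormSq x := Finset.sum_nonneg fun _ _ => sq_nonneg _
  by_contra hcon
  have h2 : simplexNormSq x = 0 := by nlinarith [sq_nonneg (simplexHeight x)]
  have h3 : simplexHeight x ^ 2 = 0 := by
    nlinarith [sq_nonneg (simplexHeight x)]
  have hd : (0 : ℝ) < d + 1 := by positivity
  have h4 : simplexMin x = 0 := by
    rcases mul_eq_zero.1 (pow_eq_zero_iff (two_ne_zero) |>.1 h3) with h | h
    · exact absurd h hd.ne'
    · exact h
  have h5 : ∀ j : Fin d, x j.succ = 1 / (d + 1) := by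
    intro j
    have := (Finset.sum_eq_zero_iff_of_nonneg (fun _ _ => sq_nonneg _)).1 h2 j (Finset.mem_univ j)
    linarith [pow_eq_zero_iff (two_ne_zero) |>.1 this]
  have h6 : x 0 = 1 / (d + 1) := by
    have h := hx.2
    rw [Fin.sum_univ_succ, Finset.sum_congr rfl fun j _ => h5 j] at h
    simp only [Finset.sum_const, Finset.card_univ, Fintype.card_fin, nsmul_eq_mul] at h
    have : (d : ℝ) * (1 / (d + 1)) + 1 / (d + 1) = 1 := by field_simp
    linarith
  obtain ⟨i, hi⟩ := exists_simplexMin_eq x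
  have : x i = 1 / (d + 1) := by
    refine Fin.cases h6 h5 i
  rw [h4, this] at hi
  have : (0 : ℝ) < 1 / (d + 1) := by positivity
  linarith

/-- The vector underlying `simplexToSphere`: the inverse stereographic projection of `ξ / u`, where
`ξ` is the position relative to the barycentre and `u` is the height. The `0`-th coordinate of `ξ`,
which is determined by the others, makes room for the axis of the projection. -/
noncomputable def simplexToSphereVec {d : ℕ} (x : Fin (d + 1) → ℝ) :
    EuclideanSpace ℝ (Fin (d + 1)) :=
  WithLp.toLp 2 (Fin.cons
    ((simplexNormSq x - simplexHeight x ^ 2) /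
      (simplexNormSq x + simplexHeight x ^ 2))
    fun j => 2 * simplexHeight x * (x j.succ - 1 / (d + 1)) /
      (simplexNormSq x + simplexHeight x ^ 2))

theorem simplexToSphereVec_zero {d : ℕ} (x : Fin (d + 1) → ℝ) :
    simplexToSphereVec x 0 = (simplexNormSq x - simplexHeight x ^ 2) /
      (simplexNormSq x + simplexHeight x ^ 2) := rfl

theorem simplexToSphereVec_succ {d : ℕ} (x : Fin (d + 1) → ℝ) (j : Fin d) :
    simplexToSphereVec x j.succ = 2 * simplexHeight x * (x j.succ - 1 / (d + 1)) /
      (simplexNormSq x + simplexHeight x ^ 2) := rfl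

theorem mem_unitSphere_iff {d : ℕ} (p : EuclideanSpace ℝ (Fin (d + 1))) :
    p ∈ Metric.sphere (0 : EuclideanSpace ℝ (Fin (d + 1))) 1 ↔
      p 0 ^ 2 + ∑ j : Fin d, p j.succ ^ 2 = 1 := by
  rw [mem_sphere_zero_iff_norm, EuclideanSpace.norm_eq, Real.sqrt_eq_one, Fin.sum_univ_succ]
  simp only [Real.norm_eq_abs, sq_abs]

theorem simplexToSphereVec_mem {d : ℕ} (x : Fin (d + 1) → ℝ)
    (hx : x ∈ stdSimplex ℝ (Fin (d + 1))) :
    simplexToSphereVec x ∈ Metric.sphere (0 : EuclideanSpace ℝ (Fin (d + 1))) 1 := by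
  have hp := (simplexNormSq_add_pos x hx).ne'
  rw [mem_unitSphere_iff, simplexToSphereVec_zero]
  simp only [simplexToSphereVec_succ, div_pow, mul_pow]
  rw [← Finset.sum_div, ← Finset.mul_sum]
  change _ + _ * simplexNormSq x / _ = _
  field_simp
  ring

/-- The map from the standard `d`-simplex onto the `d`-sphere that collapses the boundary to the
base point and is injective on the interior. -/
noncomputable def simplexToSphere (d : ℕ) (x : stdSimplex ℝ (Fin (d + 1))) : UnitSphere d :=
  ⟨simplexToSphereVec x.1, simplexToSphereVec_mem x.1 x.2⟩

theorem continuous_simplexToSphere (d : ℕ) : Continuous (simplexToSphere d) := by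
  refine Continuous.subtype_mk ?_ _
  have hm : Continuous fun x : stdSimplex ℝ (Fin (d + 1)) => simplexMin x.1 :=
    continuous_simplexMin.comp continuous_subtype_val
  have hx : ∀ i, Continuous fun x : stdSimplex ℝ (Fin (d + 1)) => x.1 i := fun i =>
    (continuous_apply i).comp continuous_subtype_val
  have hn : Continuous fun x : stdSimplex ℝ (Fin (d + 1)) => simplexNormSq x.1 := by
    unfold simplexNormSq
    exact continuous_finsetSum _ fun j _ => ((hx j.succ).sub continuous_const).pow 2
  have hne : ∀ x : stdSimplex ℝ (Fin (d + 1)),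
      simplexNormSq x.1 + simplexHeight x.1 ^ 2 ≠ 0 := fun x =>
    (simplexNormSq_add_pos x.1 x.2).ne'
  refine (PiLp.continuous_toLp 2 _).comp (continuous_pi fun i => ?_)
  refine Fin.cases ?_ (fun j => ?_) i
  · exact ((hn.sub ((continuous_const.mul hm).pow 2))).div
      (hn.add ((continuous_const.mul hm).pow 2)) hne
  · exact ((continuous_const.mul (continuous_const.mul hm)).mul ((hx j.succ).sub
      continuous_const)).div (hn.add ((continuous_const.mul hm).pow 2)) hne

theorem unitSphere_eq_base_iff {d : ℕ} (p : UnitSphere d) :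
    p = UnitSphere.base d ↔ p.1 0 = 1 := by
  constructor
  · rintro rfl
    simp [UnitSphere.base]
  · intro h
    have hp := (mem_unitSphere_iff p.1).1 p.2
    rw [h] at hp
    have hs : ∑ j : Fin d, p.1 j.succ ^ 2 = 0 := by linarith
    rw [Finset.sum_eq_zero_iff_of_nonneg fun _ _ => sq_nonneg _] at hs
    ext i
    refine Fin.cases ?_ (fun j => ?_) i
    · simp [UnitSphere.base, h]
    · have := pow_eq_zero_iff (two_ne_zero) |>.1 (hs j (Finset.mem_univ j))
      simp [UnitSphere.base, this]

theorem simplexMin_nonneg {d : ℕ} (x : stdSimplex ℝ (Fin (d + 1))) : 0 ≤ simplexMin x.1 := by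
  obtain ⟨i, hi⟩ := exists_simplexMin_eq x.1
  rw [hi]
  exact x.2.1 i

theorem simplexToSphere_eq_base_iff {d : ℕ} (x : stdSimplex ℝ (Fin (d + 1))) :
    simplexToSphere d x = UnitSphere.base d ↔ simplexMin x.1 = 0 := by
  have hp := (simplexNormSq_add_pos x.1 x.2)
  have hd : (d + 1 : ℝ) ≠ 0 := by positivity
  rw [unitSphere_eq_base_iff]
  change simplexToSphereVec x.1 0 = 1 ↔ _
  rw [simplexToSphereVec_zero, div_eq_one_iff_eq hp.ne']
  constructor
  · intro h
    have : simplexHeight x.1 ^ 2 = 0 := by linarith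
    simpa [simplexHeight, hd] using this
  · intro h
    simp [simplexHeight, h]

theorem one_sub_simplexToSphere_zero {d : ℕ} (x : stdSimplex ℝ (Fin (d + 1))) :
    1 - (simplexToSphere d x).1 0 = 2 * simplexHeight x.1 ^ 2 /
      (simplexNormSq x.1 + simplexHeight x.1 ^ 2) := by
  have hp := (simplexNormSq_add_pos x.1 x.2).ne'
  change 1 - simplexToSphereVec x.1 0 = _
  rw [simplexToSphereVec_zero]
  field_simp
  ring

/-- The stereographic coordinates of the image of an interior point. -/
theorem simplexToSphere_stereographic {d : ℕ} (x : stdSimplex ℝ (Fin (d + 1)))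
    (hx : simplexMin x.1 ≠ 0) (j : Fin d) :
    (simplexToSphere d x).1 j.succ / (1 - (simplexToSphere d x).1 0) =
      (x.1 j.succ - 1 / (d + 1)) / simplexHeight x.1 := by
  have hp := (simplexNormSq_add_pos x.1 x.2).ne'
  have hu : simplexHeight x.1 ≠ 0 := mul_ne_zero (by positivity) hx
  rw [one_sub_simplexToSphere_zero]
  change simplexToSphereVec x.1 j.succ / _ = _
  rw [simplexToSphereVec_succ]
  generalize x.1 j.succ - 1 / ((d : ℝ) + 1) = ξ
  field_simp

/-- The position relative to the barycentre is recovered from its quotient `η` by `u`: since the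
smallest coordinate of `η` is `(u - 1) / ((d + 1) u)`, it determines `u`. -/
theorem simplexToSphere_injOn {d : ℕ} (x y : stdSimplex ℝ (Fin (d + 1)))
    (h : simplexToSphere d x = simplexToSphere d y)
    (hx : simplexToSphere d x ≠ UnitSphere.base d) : x = y := by
  have hy : simplexToSphere d y ≠ UnitSphere.base d := h ▸ hx
  rw [Ne, simplexToSphere_eq_base_iff] at hx hy
  have hd : (0 : ℝ) < d + 1 := by positivity
  have hx0 : 0 < simplexMin x.1 := lt_of_le_of_ne (simplexMin_nonneg x) (Ne.symm hx)
  have hy0 : 0 < simplexMin y.1 := lt_of_le_of_ne (simplexMin_nonneg y) (Ne.symm hy)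
  have hs : ∀ j : Fin d, (x.1 j.succ - 1 / (d + 1)) / simplexHeight x.1 =
      (y.1 j.succ - 1 / (d + 1)) / simplexHeight y.1 := fun j => by
    rw [← simplexToSphere_stereographic x hx, ← simplexToSphere_stereographic y hy, h]
  have hsum : ∀ z : stdSimplex ℝ (Fin (d + 1)),
      z.1 0 - 1 / (d + 1) = - ∑ j : Fin d, (z.1 j.succ - 1 / (d + 1)) := by
    intro z
    have := z.2.2
    rw [Fin.sum_univ_succ] at this
    rw [Finset.sum_sub_distrib]
    simp only [Finset.sum_const, Finset.card_univ, Fintype.card_fin, nsmul_eq_mul]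
    have h1 : (d : ℝ) * (1 / (d + 1)) + 1 / (d + 1) = 1 := by field_simp
    linarith
  have hall : ∀ i, (x.1 i - 1 / (d + 1)) / simplexHeight x.1 =
      (y.1 i - 1 / (d + 1)) / simplexHeight y.1 := by
    intro i
    refine Fin.cases ?_ hs i
    rw [hsum, hsum, neg_div, neg_div, Finset.sum_div, Finset.sum_div]
    rw [Finset.sum_congr rfl fun j _ => hs j]
  set u := simplexHeight x.1 with hu
  set v := simplexHeight y.1 with hv
  have hu0 : 0 < u := mul_pos hd hx0
  have hv0 : 0 < v := mul_pos hd hy0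
  have hmin : ∀ (z : Fin (d + 1) → ℝ) (a : ℝ), 0 < a →
      simplexMin (fun i => (z i - 1 / (d + 1)) / a) = (simplexMin z - 1 / (d + 1)) / a := by
    intro z a ha
    have := simplexMin_affine z (1 / a) (- (1 / (d + 1)) / a) (by positivity)
    convert this using 1
    · congr 1
      funext i
      ring
    · ring
  have huv : u = v := by
    have h1 := hmin x.1 u hu0
    have h2 := hmin y.1 v hv0
    rw [funext hall, h2] at h1
    have h3 : simplexMin x.1 = u / (d + 1) := by rw [hu, simplexHeight]; field_simp
    have h4 : simplexMin y.1 = v / (d + 1) := by rw [hv, simplexHeight]; field_simp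
    rw [h3, h4] at h1
    field_simp at h1
    linarith
  refine Subtype.ext (funext fun i => ?_)
  have := hall i
  rw [huv] at this
  exact sub_left_inj.1 ((div_left_inj' hv0.ne').1 this)

theorem exists_simplexToSphere_eq (d : ℕ) (p : UnitSphere d) (hp : p ≠ UnitSphere.base d) :
    ∃ x, simplexToSphere d x = p := by
  have hd : (0 : ℝ) < d + 1 := by positivity
  have hsph := (mem_unitSphere_iff p.1).1 p.2
  have hp0 : p.1 0 ≠ 1 := fun h => hp ((unitSphere_eq_base_iff p).2 h)
  set P := p.1 0 with hP
  have hP1 : 1 - P ≠ 0 := fun h => hp0 (by linarith)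
  -- `y` is the stereographic projection of `p`, completed to a vector with coordinate sum `0`.
  let y : Fin (d + 1) → ℝ := Fin.cons (-∑ j : Fin d, p.1 j.succ / (1 - P))
    fun j => p.1 j.succ / (1 - P)
  have hysum : ∑ i, y i = 0 := by
    rw [Fin.sum_univ_succ]
    simp [y]
  set m := simplexMin y with hm
  have hm0 : m ≤ 0 := by
    by_contra hcon
    have : 0 < ∑ i, y i := Finset.sum_pos
      (fun i _ => lt_of_lt_of_le (not_le.1 hcon) (simplexMin_le y i)) Finset.univ_nonempty
    linarith
  set s := 1 - (d + 1) * m with hs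
  have hs0 : 0 < s := by nlinarith
  have hms : m = (1 - s) / (d + 1) := by rw [hs]; field_simp; ring
  let x : Fin (d + 1) → ℝ := fun i => 1 / (d + 1) + 1 / s * y i
  have hxm : simplexMin x = 1 / ((d + 1) * s) := by
    rw [simplexMin_affine y _ _ (by positivity), ← hm, hms]
    field_simp
    ring
  have hx : x ∈ stdSimplex ℝ (Fin (d + 1)) := by
    refine ⟨fun i => le_trans ?_ (simplexMin_le x i), ?_⟩
    · rw [hxm]
      positivity
    · simp only [x, Finset.sum_add_distrib, ← Finset.mul_sum, hysum]
      simp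
      field_simp
  have hu : simplexHeight x = 1 / s := by rw [simplexHeight, hxm]; field_simp
  have hyj : ∀ j : Fin d, y j.succ = p.1 j.succ / (1 - P) := fun j => rfl
  have hxj : ∀ j : Fin d, x j.succ - 1 / (d + 1) = p.1 j.succ / ((1 - P) * s) := fun j => by
    change 1 / ((d : ℝ) + 1) + 1 / s * y j.succ - 1 / (d + 1) = _
    rw [hyj]
    field_simp
    ring
  have hn : simplexNormSq x = (1 - P ^ 2) / ((1 - P) * s) ^ 2 := by
    unfold simplexNormSq
    simp only [hxj, div_pow, ← Finset.sum_div]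
    congr 1
    linarith
  have hden : simplexNormSq x + simplexHeight x ^ 2 = 2 / ((1 - P) * s ^ 2) := by
    rw [hn, hu]
    field_simp
    ring
  refine ⟨⟨x, hx⟩, Subtype.ext ?_⟩
  change simplexToSphereVec x = p.1
  ext i
  refine Fin.cases ?_ (fun j => ?_) i
  · rw [simplexToSphereVec_zero, hden, hn, hu, ← hP]
    field_simp
    ring
  · rw [simplexToSphereVec_succ, hden, hu, hxj]
    field_simp

/-! ### Collapses -/

theorem simplexMin_comp_nonneg {V : Type*} {d : ℕ} (e : Fin (d + 1) ↪ V) {x : V → ℝ}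
    (hx : ∀ v, 0 ≤ x v) : 0 ≤ simplexMin (x ∘ e) := by
  obtain ⟨k, hk⟩ := exists_simplexMin_eq (x ∘ e)
  rw [hk]
  exact hx _

theorem simplexMin_comp_eq_zero {V : Type*} {d : ℕ} (e : Fin (d + 1) ↪ V) {x : V → ℝ}
    (hx : ∀ v, 0 ≤ x v) {θ : Finset V} (hθ : ∀ v, v ∉ θ → x v = 0)
    (h : ¬ Finset.univ.map e ⊆ θ) : simplexMin (x ∘ e) = 0 := by
  obtain ⟨v, hv, hvθ⟩ := Finset.not_subset.1 h
  obtain ⟨k, -, rfl⟩ := Finset.mem_map.1 hv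
  refine le_antisymm ?_ (simplexMin_comp_nonneg e hx)
  have := simplexMin_le (x ∘ e) k
  rwa [Function.comp_apply, hθ _ hvθ] at this

theorem sum_indicator_map {V : Type*} [Fintype V] [DecidableEq V] {d : ℕ} (e : Fin (d + 1) ↪ V) :
    ∑ v, (if v ∈ Finset.univ.map e then (1 : ℝ) else 0) = d + 1 := by
  rw [Finset.sum_boole, Finset.filter_univ_mem, Finset.card_map, Finset.card_univ,
    Fintype.card_fin]
  push_cast
  rfl

/-- A generalized collapse: if every face containing `ρ` can be enlarged by the vertex `p`, then all
faces containing `ρ` may be removed. On the realization, the smallest coordinate over `ρ` is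
subtracted from each vertex of `ρ` and the mass gained is moved to `p`. -/
theorem nonempty_homotopyEquiv_of_collapse {V : Type*} [Fintype V] [DecidableEq V]
    (K K' : PreAbstractSimplicialComplex V) (ρ : Finset V) (hρ : ρ.Nonempty) (p : V) (hpρ : p ∉ ρ)
    (hK' : ∀ θ, θ ∈ K'.faces ↔ θ ∈ K.faces ∧ ¬ ρ ⊆ θ)
    (hp : ∀ θ ∈ K.faces, ρ ⊆ θ → insert p θ ∈ K.faces) :
    Nonempty (ContinuousMap.HomotopyEquiv (geometricRealization K) (geometricRealization K')) := by
  obtain ⟨d, e, rfl⟩ : ∃ (d : ℕ) (e : Fin (d + 1) ↪ V), ρ = Finset.univ.map e := by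
    have hc : ρ.card = (ρ.card - 1) + 1 := by have := hρ.card_pos; omega
    refine ⟨ρ.card - 1, (ρ.equivFinOfCardEq hc).symm.toEmbedding.trans
      (Function.Embedding.subtype _), ?_⟩
    rw [← Finset.map_map, Finset.map_univ_equiv, Finset.univ_eq_attach, Finset.attach_map_val]
  set ρ := Finset.univ.map e with hρe
  let m : (V → ℝ) → ℝ := fun x => simplexMin (x ∘ e)
  have hmc : Continuous m := continuous_simplexMin.comp (by fun_prop)
  let g : ℝ → (V → ℝ) → V → ℝ := fun t x v =>
    x v + t * m x * ((if v = p then (d + 1 : ℝ) else 0) - if v ∈ ρ then 1 else 0)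
  have hgc : Continuous fun q : ℝ × (V → ℝ) => g q.1 q.2 := by
    refine continuous_pi fun v => ?_
    have : Continuous fun q : ℝ × (V → ℝ) => m q.2 := hmc.comp continuous_snd
    fun_prop
  have hgS : ∀ t ∈ I, ∀ x ∈ stdSimplex ℝ V, g t x ∈ stdSimplex ℝ V := by
    intro t ht x hx
    have hm0 : 0 ≤ m x := simplexMin_comp_nonneg e hx.1
    have htm : 0 ≤ t * m x := mul_nonneg ht.1 hm0
    refine ⟨fun v => ?_, ?_⟩
    · by_cases hv : v ∈ ρ
      · have hvp : v ≠ p := fun h => hpρ (h ▸ hv)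
        obtain ⟨k, -, hk⟩ := Finset.mem_map.1 hv
        have h1 : m x ≤ x v := hk ▸ simplexMin_le (x ∘ e) k
        have h2 : t * m x ≤ m x := mul_le_of_le_one_left hm0 ht.2
        simp only [g, hvp, hv, if_true, if_false]
        linarith
      · have := hx.1 v
        simp only [g, hv, if_false, sub_zero]
        split_ifs <;> positivity
    · simp only [g, Finset.sum_add_distrib, ← Finset.mul_sum, Finset.sum_sub_distrib]
      rw [sum_indicator_map, hx.2]
      simp
  have hgid : ∀ t x θ, (∀ v, 0 ≤ x v) → (∀ v, v ∉ θ → x v = 0) → ¬ ρ ⊆ θ → g t x = x := by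
    intro t x θ hx hθ hρθ
    have : m x = 0 := simplexMin_comp_eq_zero e hx hθ hρθ
    funext v
    simp [g, this]
  have hgsupp : ∀ t x θ, (∀ v, v ∉ θ → x v = 0) → ρ ⊆ θ → ∀ v, v ∉ insert p θ → g t x v = 0 := by
    intro t x θ hθ hρθ v hv
    rw [Finset.mem_insert, not_or] at hv
    have hvρ : v ∉ ρ := fun h => hv.2 (hρθ h)
    simp only [g, hv.1, hθ v hv.2, hvρ, if_false, sub_zero, mul_zero, add_zero]
  have hgK : ∀ t ∈ I, ∀ x ∈ geometricRealization K, g t x ∈ geometricRealization K := by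
    rintro t ht x ⟨hx, θ, hθK, hθ⟩
    refine ⟨hgS t ht x hx, ?_⟩
    by_cases h : ρ ⊆ θ
    · exact ⟨_, hp θ hθK h, hgsupp t x θ hθ h⟩
    · rw [hgid t x θ hx.1 hθ h]
      exact ⟨θ, hθK, hθ⟩
  have hgK' : ∀ x ∈ geometricRealization K, g 1 x ∈ geometricRealization K' := by
    rintro x ⟨hx, θ, hθK, hθ⟩
    refine ⟨hgS 1 ⟨zero_le_one, le_rfl⟩ x hx, ?_⟩
    by_cases h : ρ ⊆ θ
    · obtain ⟨k, hk⟩ := exists_simplexMin_eq (x ∘ e)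
      have hkρ : e k ∈ ρ := Finset.mem_map_of_mem e (Finset.mem_univ k)
      have hkp : e k ≠ p := fun h => hpρ (h ▸ hkρ)
      refine ⟨(insert p θ).erase (e k), (hK' _).2 ⟨?_, ?_⟩, fun v hv => ?_⟩
      · exact (K.isRelLowerSet_faces (hp θ hθK h)).2 (Finset.erase_subset _ _)
          ⟨p, Finset.mem_erase.2 ⟨hkp.symm, Finset.mem_insert_self _ _⟩⟩
      · exact fun hs => Finset.notMem_erase _ _ (hs hkρ)
      · by_cases hvk : v = e k
        · subst hvk
          have : m x = x (e k) := hk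
          simp [g, hkp, hkρ, this]
        · exact hgsupp 1 x θ hθ h v fun hv' => hv (Finset.mem_erase.2 ⟨hvk, hv'⟩)
    · rw [hgid 1 x θ hx.1 hθ h]
      exact ⟨θ, (hK' _).2 ⟨hθK, h⟩, hθ⟩
  have hsub : geometricRealization K' ⊆ geometricRealization K := by
    rintro x ⟨hx, θ, hθK, hθ⟩
    exact ⟨hx, θ, ((hK' _).1 hθK).1, hθ⟩
  have hfix : ∀ x ∈ geometricRealization K', ∀ t, g t x = x := by
    rintro x ⟨hx, θ, hθK, hθ⟩ t
    exact hgid t x θ hx.1 hθ ((hK' _).1 hθK).2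
  have hg0 : ∀ x, g 0 x = x := fun x => by funext v; simp [g]
  let r : C(geometricRealization K, geometricRealization K') :=
    ⟨fun x => ⟨g 1 x, hgK' x x.2⟩,
      (hgc.comp (Continuous.prodMk continuous_const continuous_subtype_val)).subtype_mk _⟩
  let i : C(geometricRealization K', geometricRealization K) :=
    ⟨Set.inclusion hsub, continuous_inclusion hsub⟩
  refine ⟨⟨r, i, ContinuousMap.Homotopic.symm ⟨⟨⟨fun q => ⟨g q.1 q.2, hgK q.1 q.1.2 q.2 q.2.2⟩,
    ?_⟩, ?_, ?_⟩⟩, ?_⟩⟩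
  · exact (hgc.comp (Continuous.prodMk (continuous_subtype_val.comp continuous_fst)
      (continuous_subtype_val.comp continuous_snd))).subtype_mk _
  · exact fun x => Subtype.ext (hg0 x)
  · exact fun x => rfl
  · have : r.comp i = ContinuousMap.id _ := by
      ext1 x
      exact Subtype.ext (hfix x x.2 1)
    rw [this]

/-- Discrete Morse theory without critical cells: `K` collapses onto `M` if the faces outside `M`
are disjointly paired as `ρ i`, `insert (p i) (ρ i)`, and are ranked so that any face of `K`
containing `ρ i` lies in its pair or in a pair of larger rank. -/
theorem nonempty_homotopyEquiv_of_matching {V ι R : Type*} [Fintype V] [DecidableEq V]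
    [LinearOrder R] (M : PreAbstractSimplicialComplex V) (ρ : ι → Finset V) (p : ι → V) (r : ι → R)
    (hρ : ∀ i, (ρ i).Nonempty) (hp : ∀ i, p i ∉ ρ i) (hM : ∀ i, ρ i ∉ M.faces)
    (J : Finset ι) (K : PreAbstractSimplicialComplex V)
    (hdisj : ∀ i ∈ J, ∀ j ∈ J, i ≠ j → ρ i ≠ ρ j ∧ ρ i ≠ insert (p j) (ρ j) ∧
      insert (p i) (ρ i) ≠ insert (p j) (ρ j))
    (hK : ∀ θ, θ ∈ K.faces ↔ θ ∈ M.faces ∨ ∃ i ∈ J, θ = ρ i ∨ θ = insert (p i) (ρ i))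
    (hr : ∀ i ∈ J, ∀ θ ∈ K.faces, ρ i ⊆ θ → θ = ρ i ∨ θ = insert (p i) (ρ i) ∨
      ∃ j ∈ J, (θ = ρ j ∨ θ = insert (p j) (ρ j)) ∧ r i < r j) :
    Nonempty (ContinuousMap.HomotopyEquiv (geometricRealization K) (geometricRealization M)) := by
  classical
  induction hn : J.card generalizing J K with
  | zero =>
    rw [Finset.card_eq_zero] at hn
    subst hn
    have : K = M := PreAbstractSimplicialComplex.ext (Set.ext fun θ => by simp [hK])
    rw [this]
    exact ⟨ContinuousMap.HomotopyEquiv.refl _⟩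
  | succ n ih =>
    obtain ⟨i, hi, hmax⟩ := J.exists_max_image r (Finset.card_pos.1 (by omega))
    have htop : ∀ θ ∈ K.faces, ρ i ⊆ θ → θ = ρ i ∨ θ = insert (p i) (ρ i) := by
      intro θ hθ hs
      rcases hr i hi θ hθ hs with h | h | ⟨j, hj, -, hlt⟩
      · exact Or.inl h
      · exact Or.inr h
      · exact absurd hlt (not_lt.2 (hmax j hj))
    have hiK : insert (p i) (ρ i) ∈ K.faces := (hK _).2 (Or.inr ⟨i, hi, Or.inr rfl⟩)
    let K' : PreAbstractSimplicialComplex V :=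
      { faces := {θ | θ ∈ K.faces ∧ ¬ ρ i ⊆ θ}
        isRelLowerSet_faces := fun θ hθ => ⟨(K.isRelLowerSet_faces hθ.1).1, fun τ hτ hne =>
          ⟨(K.isRelLowerSet_faces hθ.1).2 hτ hne, fun h => hθ.2 (h.trans hτ)⟩⟩ }
    have hK'mem : ∀ θ, θ ∈ K'.faces ↔ θ ∈ K.faces ∧ ¬ ρ i ⊆ θ := fun θ => Iff.rfl
    obtain ⟨h1⟩ := nonempty_homotopyEquiv_of_collapse K K' (ρ i) (hρ i) (p i) (hp i) hK'mem (by
      intro θ hθ hs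
      rcases htop θ hθ hs with rfl | rfl
      · exact hiK
      · rwa [Finset.insert_idem])
    have hK' : ∀ θ, θ ∈ K'.faces ↔
        θ ∈ M.faces ∨ ∃ j ∈ J.erase i, θ = ρ j ∨ θ = insert (p j) (ρ j) := by
      intro θ
      rw [hK'mem]
      constructor
      · rintro ⟨hθ, hs⟩
        rcases (hK θ).1 hθ with h | ⟨j, hj, h⟩
        · exact Or.inl h
        · refine Or.inr ⟨j, Finset.mem_erase.2 ⟨?_, hj⟩, h⟩
          rintro rfl
          rcases h with rfl | rfl
          · exact hs (Finset.Subset.refl _)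
          · exact hs (Finset.subset_insert _ _)
      · rintro (h | ⟨j, hj, h⟩)
        · exact ⟨(hK θ).2 (Or.inl h), fun hs =>
            hM i ((M.isRelLowerSet_faces h).2 hs (hρ i))⟩
        · obtain ⟨hji, hj⟩ := Finset.mem_erase.1 hj
          have hθ : θ ∈ K.faces := (hK θ).2 (Or.inr ⟨j, hj, h⟩)
          refine ⟨hθ, fun hs => ?_⟩
          have d1 := hdisj i hi j hj (Ne.symm hji)
          have d2 := hdisj j hj i hi hji
          rcases htop θ hθ hs with h' | h' <;> rcases h with h | h
          · exact d1.1 (h'.symm.trans h)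
          · exact d1.2.1 (h'.symm.trans h)
          · exact d2.2.1 (h.symm.trans h')
          · exact d1.2.2 (h'.symm.trans h)
    obtain ⟨h2⟩ := ih (J.erase i) K'
      (fun j hj k hk => hdisj j (Finset.mem_of_mem_erase hj) k (Finset.mem_of_mem_erase hk)) hK'
      (by
        intro j hj θ hθ hs
        rcases hr j (Finset.mem_of_mem_erase hj) θ ((hK'mem θ).1 hθ).1 hs with h | h | ⟨k, hk, h, hlt⟩
        · exact Or.inl h
        · exact Or.inr (Or.inl h)
        · refine Or.inr (Or.inr ⟨k, Finset.mem_erase.2 ⟨?_, hk⟩, h, hlt⟩)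
          rintro rfl
          refine ((hK'mem θ).1 hθ).2 ?_
          rcases h with rfl | rfl
          · exact Finset.Subset.refl _
          · exact Finset.subset_insert _ _)
      (by rw [Finset.card_erase_of_mem hi, hn]; rfl)
    exact ⟨h1.trans h2⟩

/-! ### A cone with cells attached along their boundaries -/

/-- The weights used to contract a cone with cells attached, at time `t`. A point of a cell at
height `u` is a combination of the barycentre (of weight `u`) and a boundary point; the
homotopy scales the latter by `coneScale t u`, gives the former the weight `coneHeight t u`, and the
apex `coneApex t u`. So the cell is stretched until its points reach the boundary, from where they
move straight to the apex. The maximum with `1 / 2` only avoids a division by zero. -/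
noncomputable def coneScale (t u : ℝ) : ℝ :=
  min (1 + t) (2 / max (1 - u) (1 / 2) - (1 + t))

/-- The weight of the barycentre of a cell; see `coneScale`. -/
noncomputable def coneHeight (t u : ℝ) : ℝ := max 0 ((1 + t) * u - t)

/-- The weight of the apex; see `coneScale`. -/
noncomputable def coneApex (t u : ℝ) : ℝ := max 0 (t - (1 + t) * u)

theorem coneScale_nonneg {t u : ℝ} (ht : t ∈ I) (hu : u ∈ I) : 0 ≤ coneScale t u := by
  have h1 : 1 ≤ 1 / max (1 - u) (1 / 2) := by
    rw [le_div_iff₀ (by positivity), one_mul]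
    exact max_le (by linarith [hu.1]) (by norm_num)
  have h2 : 2 / max (1 - u) (1 / 2) = 2 * (1 / max (1 - u) (1 / 2)) := by ring
  refine le_min (by linarith [ht.1]) ?_
  rw [h2]
  linarith [ht.2]

theorem coneScale_mul {t u : ℝ} (ht : t ∈ I) (hu : u ∈ I) :
    coneScale t u * (1 - u) + coneHeight t u + coneApex t u = 1 := by
  obtain ⟨ht0, ht1⟩ := ht
  obtain ⟨hu0, hu1⟩ := hu
  unfold coneScale coneHeight coneApex
  rcases le_total t ((1 + t) * u) with h | h
  · rw [max_eq_right (by linarith : (0 : ℝ) ≤ (1 + t) * u - t),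
      max_eq_left (by linarith : t - (1 + t) * u ≤ 0), min_eq_left]
    · ring
    · have : 1 + t ≤ 1 / max (1 - u) (1 / 2) := by
        rw [le_div_iff₀ (by positivity)]
        rcases max_cases (1 - u) (1 / 2) with ⟨h', -⟩ | ⟨h', -⟩ <;> rw [h'] <;> nlinarith
      have h2 : 2 / max (1 - u) (1 / 2) = 2 * (1 / max (1 - u) (1 / 2)) := by ring
      linarith
  · have hρ : 1 / 2 ≤ 1 - u := by nlinarith
    rw [max_eq_left (by linarith : (1 + t) * u - t ≤ 0),
      max_eq_right (by linarith : (0 : ℝ) ≤ t - (1 + t) * u), max_eq_left hρ, min_eq_right]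
    · field_simp
      ring
    · have : 1 / (1 - u) ≤ 1 + t := by
        rw [div_le_iff₀ (by linarith)]
        nlinarith
      have h2 : 2 / (1 - u) = 2 * (1 / (1 - u)) := by ring
      linarith

theorem coneHeight_mul_coneApex (t u : ℝ) : coneHeight t u = 0 ∨ coneApex t u = 0 := by
  unfold coneHeight coneApex
  rcases le_total t ((1 + t) * u) with h | h
  · exact Or.inr (max_eq_left (by linarith))
  · exact Or.inl (max_eq_left (by linarith))

theorem coneScale_zero_right {t : ℝ} (ht : t ∈ I) : coneScale t 0 = 1 - t := by
  have := ht.1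
  unfold coneScale
  rw [sub_zero, max_eq_left (by norm_num), min_eq_right (by linarith)]
  ring

theorem coneHeight_zero_right {t : ℝ} (ht : t ∈ I) : coneHeight t 0 = 0 := by
  have := ht.1
  exact max_eq_left (by linarith)

theorem coneApex_zero_right {t : ℝ} (ht : t ∈ I) : coneApex t 0 = t := by
  have := ht.1
  unfold coneApex
  rw [mul_zero, sub_zero, max_eq_right this]

theorem coneHeight_zero_left {u : ℝ} (hu : u ∈ I) : coneHeight 0 u = u := by
  have := hu.1
  unfold coneHeight
  rw [add_zero, one_mul, sub_zero, max_eq_right this]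

theorem coneApex_zero_left {u : ℝ} (hu : u ∈ I) : coneApex 0 u = 0 := by
  have := hu.1
  exact max_eq_left (by linarith)

theorem coneScale_zero_left {u : ℝ} (hu : u ∈ I) : coneScale 0 u = 1 := by
  unfold coneScale
  rw [add_zero, min_eq_left]
  have : 1 ≤ 1 / max (1 - u) (1 / 2) := by
    rw [le_div_iff₀ (by positivity), one_mul]
    exact max_le (by linarith [hu.1]) (by norm_num)
  have h2 : 2 / max (1 - u) (1 / 2) = 2 * (1 / max (1 - u) (1 / 2)) := by ring
  linarith

/-- A cone with apex `v₀`, to which `r` simplices `e i` of dimension `d` are attached along their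
boundaries, is a wedge of `r` spheres of dimension `d`. -/
theorem nonempty_homotopyEquiv_wedgeOfSpheres {V : Type*} [Fintype V] [DecidableEq V]
    (M : PreAbstractSimplicialComplex V) (v₀ : V) {d r : ℕ} (e : Fin r → Fin (d + 1) ↪ V)
    (hv₀ : {v₀} ∈ M.faces)
    (hinj : ∀ i j, Finset.univ.map (e i) = Finset.univ.map (e j) → i = j)
    (he : ∀ i, insert v₀ (Finset.univ.map (e i)) ∉ M.faces)
    (hM : ∀ θ ∈ M.faces, insert v₀ θ ∈ M.faces ∨ ∃ i, θ = Finset.univ.map (e i))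
    (heM : ∀ i, Finset.univ.map (e i) ∈ M.faces)
    (hbd : ∀ i, ∀ θ ⊂ Finset.univ.map (e i), insert v₀ θ ∈ M.faces) :
    Nonempty (ContinuousMap.HomotopyEquiv (geometricRealization M) (WedgeOfSpheres r d)) := by
  let X := geometricRealization M
  let m : Fin r → (V → ℝ) → ℝ := fun i x => simplexMin (x ∘ e i)
  have hd : (0 : ℝ) < d + 1 := by positivity
  have hmc : ∀ i, Continuous (m i) := fun i => continuous_simplexMin.comp (by fun_prop)
  have hmcone : ∀ x : V → ℝ, (∀ v, 0 ≤ x v) → ∀ θ ∈ M.faces, v₀ ∈ θ → (∀ v, v ∉ θ → x v = 0) →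
      ∀ i, m i x = 0 := by
    intro x hx θ hθM hvθ hθ i
    refine simplexMin_comp_eq_zero (e i) hx hθ fun hs => he i ?_
    exact (M.isRelLowerSet_faces hθM).2 (Finset.insert_subset hvθ hs) (Finset.insert_nonempty _ _)
  -- A point of a cell whose smallest coordinate on that cell vanishes lies in the cone.
  have hbd' : ∀ x : V → ℝ, ∀ i k, (∀ v, v ∉ Finset.univ.map (e i) → x v = 0) → x (e i k) = 0 →
      ∃ θ ∈ M.faces, v₀ ∈ θ ∧ ∀ v, v ∉ θ → x v = 0 := by
    intro x i k hx hk
    have hmem : e i k ∈ Finset.univ.map (e i) := Finset.mem_map_of_mem _ (Finset.mem_univ k)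
    refine ⟨insert v₀ ((Finset.univ.map (e i)).erase (e i k)),
      hbd i _ (Finset.erase_ssubset hmem), Finset.mem_insert_self _ _, fun v hv => ?_⟩
    by_cases hvk : v = e i k
    · rw [hvk, hk]
    · exact hx v fun h => hv (Finset.mem_insert_of_mem (Finset.mem_erase.2 ⟨hvk, h⟩))
  have hcases : ∀ x ∈ X, ((∀ i, m i x = 0) ∧ ∃ θ ∈ M.faces, v₀ ∈ θ ∧ ∀ v, v ∉ θ → x v = 0) ∨
      ∃ i, m i x ≠ 0 ∧ (∀ j, j ≠ i → m j x = 0) ∧ ∀ v, v ∉ Finset.univ.map (e i) → x v = 0 := by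
    rintro x ⟨hx, θ, hθM, hθ⟩
    have hcone : (∃ θ ∈ M.faces, v₀ ∈ θ ∧ ∀ v, v ∉ θ → x v = 0) → ((∀ i, m i x = 0) ∧
        ∃ θ ∈ M.faces, v₀ ∈ θ ∧ ∀ v, v ∉ θ → x v = 0) := by
      rintro ⟨θ, h1, h2, h3⟩
      exact ⟨hmcone x hx.1 θ h1 h2 h3, θ, h1, h2, h3⟩
    rcases hM θ hθM with h | ⟨i, rfl⟩
    · exact Or.inl (hcone ⟨_, h, Finset.mem_insert_self _ _,
        fun v hv => hθ v fun h' => hv (Finset.mem_insert_of_mem h')⟩)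
    · by_cases hm : m i x = 0
      · obtain ⟨k, hk⟩ := exists_simplexMin_eq (x ∘ e i)
        exact Or.inl (hcone (hbd' x i k hθ (hk.symm.trans hm)))
      · refine Or.inr ⟨i, hm, fun j hj => ?_, hθ⟩
        refine simplexMin_comp_eq_zero (e j) hx.1 hθ fun hs => hj ?_
        exact hinj _ _ (Finset.eq_of_subset_of_card_le hs (by simp only [Finset.card_map, le_refl]))
  let D := stdSimplex ℝ (Fin (d + 1))
  have hmI : ∀ i, ∀ x ∈ stdSimplex ℝ V, (d + 1) * m i x ∈ I := by
    intro i x hx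
    refine ⟨mul_nonneg hd.le (simplexMin_comp_nonneg _ hx.1), ?_⟩
    have h1 : ∑ k : Fin (d + 1), m i x ≤ ∑ k, x (e i k) :=
      Finset.sum_le_sum fun k _ => simplexMin_le (x ∘ e i) k
    have h2 : ∑ k, x (e i k) ≤ ∑ v, x v := by
      rw [← Finset.sum_map Finset.univ (e i) x]
      exact Finset.sum_le_sum_of_subset_of_nonneg (Finset.subset_univ _) fun v _ _ => hx.1 v
    rw [hx.2] at h2
    simp only [Finset.sum_const, Finset.card_univ, Fintype.card_fin, nsmul_eq_mul] at h1
    push_cast at h1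
    linarith
  let u : (V → ℝ) → ℝ := fun x => ∑ i, (d + 1) * m i x
  have huc : Continuous u := continuous_finsetSum _ fun i _ => continuous_const.mul (hmc i)
  let χ : Fin r → V → ℝ := fun i v => if v ∈ Finset.univ.map (e i) then 1 else 0
  let g : ℝ → (V → ℝ) → V → ℝ := fun t x v =>
    coneScale t (u x) * (x v - ∑ i, m i x * χ i v) +
      ∑ i, coneHeight t ((d + 1) * m i x) / (d + 1) * χ i v +
      coneApex t (u x) * if v = v₀ then 1 else 0
  have hgc : Continuous fun q : ℝ × (V → ℝ) => g q.1 q.2 := by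
    have hu' : Continuous fun q : ℝ × (V → ℝ) => u q.2 := huc.comp continuous_snd
    have hm' : ∀ i, Continuous fun q : ℝ × (V → ℝ) => m i q.2 := fun i =>
      (hmc i).comp continuous_snd
    have h1 : Continuous fun q : ℝ × (V → ℝ) => coneScale q.1 (u q.2) := by
      unfold coneScale
      refine Continuous.min (by fun_prop) (Continuous.sub (Continuous.div continuous_const
        (by fun_prop) fun q => ?_) (by fun_prop))
      positivity
    have h2 : ∀ i, Continuous fun q : ℝ × (V → ℝ) => coneHeight q.1 ((d + 1) * m i q.2) := by
      intro i
      unfold coneHeight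
      fun_prop
    have h3 : Continuous fun q : ℝ × (V → ℝ) => coneApex q.1 (u q.2) := by
      unfold coneApex
      fun_prop
    refine continuous_pi fun v => ?_
    fun_prop
  have hg1 : ∀ t ∈ I, ∀ x : V → ℝ, (∀ i, m i x = 0) → ∀ v,
      g t x v = (1 - t) * x v + t * if v = v₀ then 1 else 0 := by
    intro t ht x hx v
    have hu0 : u x = 0 := by simp [u, hx]
    simp only [g, hu0, hx, coneScale_zero_right ht, coneApex_zero_right ht, mul_zero,
      coneHeight_zero_right ht, zero_mul, zero_div, Finset.sum_const_zero, sub_zero, add_zero]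
  have hg2 : ∀ t ∈ I, ∀ x : V → ℝ, ∀ i, (∀ j, j ≠ i → m j x = 0) → ∀ v,
      g t x v = coneScale t ((d + 1) * m i x) * (x v - m i x * χ i v) +
        coneHeight t ((d + 1) * m i x) / (d + 1) * χ i v +
        coneApex t ((d + 1) * m i x) * if v = v₀ then 1 else 0 := by
    intro t ht x i hx v
    have hu0 : u x = (d + 1) * m i x :=
      Finset.sum_eq_single i (fun j _ hj => by rw [hx j hj, mul_zero])
        fun h => absurd (Finset.mem_univ i) h
    have hs1 : ∑ j, m j x * χ j v = m i x * χ i v :=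
      Finset.sum_eq_single i (fun j _ hj => by rw [hx j hj, zero_mul])
        fun h => absurd (Finset.mem_univ i) h
    have hs2 : ∑ j, coneHeight t ((d + 1) * m j x) / (d + 1) * χ j v =
        coneHeight t ((d + 1) * m i x) / (d + 1) * χ i v :=
      Finset.sum_eq_single i (fun j _ hj => by
        rw [hx j hj, mul_zero, coneHeight_zero_right ht, zero_div, zero_mul])
        fun h => absurd (Finset.mem_univ i) h
    simp only [g, hu0, hs1, hs2]
  have hχ : ∀ i, ∑ v, χ i v = d + 1 := fun i => sum_indicator_map (e i)
  have hgcone : ∀ t ∈ I, ∀ x ∈ stdSimplex ℝ V, (∀ i, m i x = 0) →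
      (∃ θ ∈ M.faces, v₀ ∈ θ ∧ ∀ v, v ∉ θ → x v = 0) →
      g t x ∈ stdSimplex ℝ V ∧ ∃ θ ∈ M.faces, v₀ ∈ θ ∧ ∀ v, v ∉ θ → g t x v = 0 := by
    rintro t ht x hx hm ⟨θ, hθM, hvθ, hθ⟩
    have hg := hg1 t ht x hm
    refine ⟨⟨fun v => ?_, ?_⟩, θ, hθM, hvθ, fun v hv => ?_⟩
    · rw [hg]
      have h1 := hx.1 v
      have h2 : 0 ≤ 1 - t := by linarith [ht.2]
      have h3 := ht.1
      positivity
    · simp only [hg, Finset.sum_add_distrib, ← Finset.mul_sum, hx.2]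
      simp
    · have : v ≠ v₀ := fun h => hv (h ▸ hvθ)
      rw [hg, hθ v hv]
      simp [this]
  have hgX : ∀ t ∈ I, ∀ x ∈ X, g t x ∈ X := by
    intro t ht x hxX
    have hx : x ∈ stdSimplex ℝ V := hxX.1
    rcases hcases x hxX with ⟨hm, hθ⟩ | ⟨i, -, hj, hsupp⟩
    · obtain ⟨h1, θ, h2, -, h3⟩ := hgcone t ht x hx hm hθ
      exact ⟨h1, θ, h2, h3⟩
    · have hg := hg2 t ht x i hj
      have huI := hmI i x hx
      have hα := coneScale_nonneg ht huI
      have hsum := coneScale_mul ht huI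
      have hβ : 0 ≤ coneHeight t ((d + 1) * m i x) := le_max_left _ _
      have hγ : 0 ≤ coneApex t ((d + 1) * m i x) := le_max_left _ _
      have hw : ∀ v, 0 ≤ x v - m i x * χ i v := by
        intro v
        simp only [χ]
        split_ifs with h
        · obtain ⟨k, -, rfl⟩ := Finset.mem_map.1 h
          have := simplexMin_le (x ∘ e i) k
          simp only [Function.comp_apply] at this
          simp only [m]
          linarith
        · simpa using hx.1 v
      refine ⟨⟨fun v => ?_, ?_⟩, ?_⟩
      · rw [hg]
        have h1 := hw v
        have h2 : 0 ≤ χ i v := by simp only [χ]; split_ifs <;> norm_num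
        positivity
      · simp only [hg, Finset.sum_add_distrib, ← Finset.mul_sum, Finset.sum_sub_distrib, hx.2, hχ]
        rw [Finset.sum_ite_eq' Finset.univ v₀]
        simp only [Finset.mem_univ, if_true, mul_one]
        rw [div_mul_cancel₀ _ hd.ne', mul_comm (m i x)]
        exact hsum
      · rcases coneHeight_mul_coneApex t ((d + 1) * m i x) with h0 | h0
        · -- The weight of the barycentre vanishes: the point lies in the cone over the boundary.
          obtain ⟨k, hk⟩ := exists_simplexMin_eq (x ∘ e i)
          obtain ⟨θ, hθM, hvθ, hθ⟩ := hbd' (fun v => x v - m i x * χ i v) i k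
            (fun v hv => by simp only [χ, hsupp v hv, hv, if_false]; ring)
            (by
              have : m i x = x (e i k) := hk
              simp [χ, this])
          refine ⟨θ, hθM, fun v hv => ?_⟩
          have : v ≠ v₀ := fun h => hv (h ▸ hvθ)
          have h1 : x v - m i x * χ i v = 0 := hθ v hv
          rw [hg, h1, h0]
          simp [this]
        · refine ⟨_, heM i, fun v hv => ?_⟩
          rw [hg, h0, hsupp v hv]
          simp only [χ, hv, if_false]
          ring
  have hg0 : ∀ x ∈ X, g 0 x = x := by
    intro x hxX
    have h0 : (0 : ℝ) ∈ I := ⟨le_rfl, zero_le_one⟩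
    funext v
    rcases hcases x hxX with ⟨hm, -⟩ | ⟨i, -, hj, -⟩
    · rw [hg1 0 h0 x hm]
      ring
    · have huI := hmI i x hxX.1
      rw [hg2 0 h0 x i hj, coneScale_zero_left huI, coneHeight_zero_left huI,
        coneApex_zero_left huI]
      field_simp
      ring
  let C : Set X := {x | ∀ i, m i x = 0}
  have hCc : IsClosed C := by
    have : C = ⋂ i, {x : X | m i x = 0} := by
      ext x
      simp [C]
    rw [this]
    exact isClosed_iInter fun i =>
      isClosed_eq ((hmc i).comp continuous_subtype_val) continuous_const
  have hCcone : ∀ x : X, x ∈ C → ∃ θ ∈ M.faces, v₀ ∈ θ ∧ ∀ v, v ∉ θ → x.1 v = 0 := by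
    intro x hx
    rcases hcases x x.2 with ⟨-, h⟩ | ⟨i, hi, -⟩
    · exact h
    · exact absurd (hx i) hi
  let a' : V → ℝ := fun v => if v = v₀ then 1 else 0
  have ha' : a' ∈ stdSimplex ℝ V :=
    ⟨fun v => by simp only [a']; split_ifs <;> norm_num, by simp [a']⟩
  have ha'0 : ∀ v, v ∉ ({v₀} : Finset V) → a' v = 0 := by
    intro v hv
    simp only [Finset.mem_singleton] at hv
    simp [a', hv]
  let a : X := ⟨a', ha', {v₀}, hv₀, ha'0⟩
  have ha : a ∈ C := hmcone a' ha'.1 {v₀} hv₀ (Finset.mem_singleton_self _) ha'0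
  let ε' : Fin r → (Fin (d + 1) → ℝ) → V → ℝ := fun i y v => ∑ k, if e i k = v then y k else 0
  have hε1 : ∀ i y k, ε' i y (e i k) = y k := by
    intro i y k
    simp [ε', (e i).injective.eq_iff]
  have hε2 : ∀ i y v, v ∉ Finset.univ.map (e i) → ε' i y v = 0 := by
    intro i y v hv
    refine Finset.sum_eq_zero fun k _ => if_neg ?_
    rintro rfl
    exact hv (Finset.mem_map_of_mem _ (Finset.mem_univ k))
  have hεX : ∀ i, ∀ y ∈ D, ε' i y ∈ X := by
    intro i y hy
    refine ⟨⟨fun v => Finset.sum_nonneg fun k _ => ?_, ?_⟩, _, heM i, hε2 i y⟩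
    · split_ifs
      · exact hy.1 k
      · exact le_rfl
    · simp only [ε']
      rw [Finset.sum_comm]
      simp [hy.2]
  let ε : Fin r → D → X := fun i y => ⟨ε' i y, hεX i y y.2⟩
  have hmε : ∀ i (y : D), m i (ε i y) = simplexMin y.1 := by
    intro i y
    have : (ε' i y.1) ∘ e i = y.1 := funext fun k => hε1 i y k
    change simplexMin (ε' i y.1 ∘ e i) = _
    rw [this]
  have hmε' : ∀ i j (y : D), j ≠ i → m j (ε i y) = 0 := by
    intro i j y hj
    refine simplexMin_comp_eq_zero (e j) (hεX i y y.2).1.1 (hε2 i y) fun hs => hj ?_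
    exact hinj _ _ (Finset.eq_of_subset_of_card_le hs (by simp only [Finset.card_map, le_refl]))
  have hεC : ∀ i (y : D), ε i y ∈ C ↔ simplexToSphere d y = UnitSphere.base d := by
    intro i y
    rw [simplexToSphere_eq_base_iff, ← hmε i y]
    refine ⟨fun h => h i, fun h j => ?_⟩
    by_cases hj : j = i
    · rw [hj, h]
    · exact hmε' i j y hj
  have : CompactSpace D := isCompact_iff_compactSpace.1 (isCompact_stdSimplex ℝ (Fin (d + 1)))
  refine nonempty_homotopyEquiv_wedge C hCc a ha (UnitSphere.base d) (simplexToSphere d)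
    (continuous_simplexToSphere d) (exists_simplexToSphere_eq d) simplexToSphere_injOn ε ?_ hεC
    ?_ ?_ ⟨fun q => ⟨g q.1 q.2, hgX q.1 q.1.2 q.2 q.2.2⟩, ?_⟩ ?_ ?_ ?_
  · intro i
    refine Continuous.subtype_mk (continuous_pi fun v => continuous_finsetSum _ fun k _ => ?_) _
    split_ifs
    · exact (continuous_apply k).comp continuous_subtype_val
    · exact continuous_const
  · intro i j y z hyz hnC
    have hij : i = j := by
      by_contra hne
      refine hnC fun k => ?_
      by_cases hk : k = i
      · rw [hyz]
        exact hmε' j k z (hk ▸ hne)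
      · exact hmε' i k y hk
    subst hij
    refine ⟨rfl, Subtype.ext (funext fun k => ?_)⟩
    rw [← hε1 i y.1 k, ← hε1 i z.1 k]
    exact congrFun (congrArg Subtype.val hyz) (e i k)
  · intro x
    rcases hcases x x.2 with ⟨h, -⟩ | ⟨i, -, -, hsupp⟩
    · exact Or.inl h
    · refine Or.inr ⟨i, ⟨x.1 ∘ e i, fun k => x.2.1.1 _, ?_⟩, Subtype.ext (funext fun v => ?_)⟩
      · rw [← x.2.1.2]
        change ∑ k, x.1 (e i k) = _
        rw [← Finset.sum_map Finset.univ (e i) x.1]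
        exact Finset.sum_subset (Finset.subset_univ _) fun v _ hv => hsupp v hv
      · by_cases hv : v ∈ Finset.univ.map (e i)
        · obtain ⟨k, -, rfl⟩ := Finset.mem_map.1 hv
          exact hε1 i _ k
        · rw [hsupp v hv]
          exact hε2 i _ v hv
  · exact (hgc.comp (Continuous.prodMk (continuous_subtype_val.comp continuous_fst)
      (continuous_subtype_val.comp continuous_snd))).subtype_mk _
  · exact fun x => Subtype.ext (hg0 x x.2)
  · intro t x hx
    obtain ⟨h1, θ, h2, h3, h4⟩ := hgcone t t.2 x x.2.1 hx (hCcone x hx)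
    exact hmcone _ h1.1 θ h2 h3 h4
  · intro x hx
    refine Subtype.ext (funext fun v => ?_)
    change g 1 x v = a' v
    rw [hg1 1 ⟨zero_le_one, le_rfl⟩ x hx]
    simp [a']

end Topology

/-! ### Independent triples in the grid -/

theorem gridGraph_three_adj {n : ℕ} (u v : Fin 3 × Fin n) : (gridGraph 3 n).Adj u v ↔
    ((u.2 : ℕ) = v.2 ∧ ((u.1 : ℕ) + 1 = v.1 ∨ (v.1 : ℕ) + 1 = u.1)) ∨
    ((u.1 : ℕ) = v.1 ∧ ((u.2 : ℕ) + 1 = v.2 ∨ (v.2 : ℕ) + 1 = u.2)) := by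
  rw [gridGraph, SimpleGraph.boxProd_adj, SimpleGraph.pathGraph_adj, SimpleGraph.pathGraph_adj,
    Fin.ext_iff, Fin.ext_iff]
  tauto

/-- Two distinct nonadjacent vertices of the grid. -/
def Apart {n : ℕ} (u v : Fin 3 × Fin n) : Prop := u ≠ v ∧ ¬ (gridGraph 3 n).Adj u v

theorem apart_iff {n : ℕ} (u v : Fin 3 × Fin n) : Apart u v ↔
    ¬ ((u.1 : ℕ) = v.1 ∧ (u.2 : ℕ) = v.2) ∧
    ¬ (((u.2 : ℕ) = v.2 ∧ ((u.1 : ℕ) + 1 = v.1 ∨ (v.1 : ℕ) + 1 = u.1)) ∨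
      ((u.1 : ℕ) = v.1 ∧ ((u.2 : ℕ) + 1 = v.2 ∨ (v.2 : ℕ) + 1 = u.2))) := by
  rw [Apart, gridGraph_three_adj, Ne, Prod.ext_iff, Fin.ext_iff, Fin.ext_iff]

theorem Apart.symm {n : ℕ} {u v : Fin 3 × Fin n} (h : Apart u v) : Apart v u :=
  ⟨h.1.symm, fun h' => h.2 h'.symm⟩

/-- A set of vertices of the grid containing an independent set of size `3`. -/
def HasIndepTriple {n : ℕ} (τ : Finset (Fin 3 × Fin n)) : Prop :=
  ∃ x ∈ τ, ∃ y ∈ τ, ∃ z ∈ τ, Apart x y ∧ Apart x z ∧ Apart y z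

theorem mem_totalCutComplex_iff {n : ℕ} (σ : Finset (Fin 3 × Fin n)) :
    σ ∈ (totalCutComplex (gridGraph 3 n) 3).faces ↔ σ.Nonempty ∧ HasIndepTriple σᶜ := by
  refine and_congr_right fun _ => ⟨?_, ?_⟩
  · rintro ⟨s, ⟨hs, hc⟩, hsub⟩
    obtain ⟨x, y, z, hxy, hxz, hyz, rfl⟩ := Finset.card_eq_three.1 hc
    have hmem : ∀ v, v = x ∨ v = y ∨ v = z → v ∈ σᶜ := fun v hv => by
      rw [Finset.mem_compl]
      exact hsub (by simpa using hv)
    have hind : ∀ u v, u ≠ v → (u = x ∨ u = y ∨ u = z) → (v = x ∨ v = y ∨ v = z) → Apart u v :=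
      fun u v huv hu hv => ⟨huv, hs (by simpa using hu) (by simpa using hv) huv⟩
    exact ⟨x, hmem x (by simp), y, hmem y (by simp), z, hmem z (by simp),
      hind _ _ hxy (by simp) (by simp), hind _ _ hxz (by simp) (by simp),
      hind _ _ hyz (by simp) (by simp)⟩
  · rintro ⟨x, hx, y, hy, z, hz, hxy, hxz, hyz⟩
    refine ⟨{x, y, z}, ⟨?_, Finset.card_eq_three.2 ⟨x, y, z, hxy.1, hxz.1, hyz.1, rfl⟩⟩, ?_⟩
    · intro u hu v hv _
      simp only [Finset.coe_insert, Finset.coe_singleton, Set.mem_insert_iff,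
        Set.mem_singleton_iff] at hu hv
      rcases hu with rfl | rfl | rfl <;> rcases hv with rfl | rfl | rfl <;>
        first
          | exact SimpleGraph.irrefl _
          | exact hxy.2 | exact hxz.2 | exact hyz.2
          | exact hxy.symm.2 | exact hxz.symm.2 | exact hyz.symm.2
    · intro v hv
      simp only [Finset.coe_insert, Finset.coe_singleton, Set.mem_insert_iff,
        Set.mem_singleton_iff] at hv
      rw [Finset.mem_compl] at hx hy hz
      rcases hv with rfl | rfl | rfl <;> assumption

theorem HasIndepTriple.mono {n : ℕ} {τ τ' : Finset (Fin 3 × Fin n)} (h : HasIndepTriple τ)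
    (hs : τ ⊆ τ') : HasIndepTriple τ' := by
  obtain ⟨x, hx, y, hy, z, hz, h⟩ := h
  exact ⟨x, hs hx, y, hs hy, z, hs hz, h⟩

theorem HasIndepTriple.of_insert {n : ℕ} {τ : Finset (Fin 3 × Fin n)} {p : Fin 3 × Fin n}
    (h : HasIndepTriple (insert p τ)) :
    HasIndepTriple τ ∨ ∃ y ∈ τ, ∃ z ∈ τ, Apart p y ∧ Apart p z ∧ Apart y z := by
  obtain ⟨x, hx, y, hy, z, hz, hxy, hxz, hyz⟩ := h
  rw [Finset.mem_insert] at hx hy hz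
  rcases hx with rfl | hx
  · exact Or.inr ⟨y, hy.resolve_left hxy.1.symm, z, hz.resolve_left hxz.1.symm, hxy, hxz, hyz⟩
  · rcases hy with rfl | hy
    · exact Or.inr ⟨x, hx, z, hz.resolve_left hyz.1.symm, hxy.symm, hyz, hxz⟩
    · rcases hz with rfl | hz
      · exact Or.inr ⟨x, hx, y, hy, hxz.symm, hyz.symm, hxy⟩
      · exact Or.inl ⟨x, hx, y, hy, z, hz, hxy, hxz, hyz⟩

/-- If `p` is the only possible neighbour of `x ∈ τ` in `τ`, then `x` can replace `p` in an
independent triple. -/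
theorem HasIndepTriple.of_insert_of_adj {n : ℕ} {τ : Finset (Fin 3 × Fin n)}
    {p x : Fin 3 × Fin n} (hx : x ∈ τ) (hxp : ¬ Apart p x)
    (hτ : ∀ v ∈ τ, (gridGraph 3 n).Adj x v → v = p) (h : HasIndepTriple (insert p τ)) :
    HasIndepTriple τ := by
  rcases h.of_insert with h | ⟨y, hy, z, hz, hpy, hpz, hyz⟩
  · exact h
  · have key : ∀ v ∈ τ, Apart p v → Apart x v := by
      intro v hv hpv
      refine ⟨?_, fun h => hpv.1 (hτ v hv h).symm⟩
      rintro rfl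
      exact hxp hpv
    exact ⟨x, hx, y, hy, z, hz, key y hy hpy, key z hz hpz, hyz⟩

/-- A union of two cliques contains no independent triple. -/
theorem not_hasIndepTriple_of_cover {n : ℕ} {τ : Finset (Fin 3 × Fin n)}
    (A B : Fin 3 × Fin n → Prop) (hA : ∀ u v, A u → A v → ¬ Apart u v)
    (hB : ∀ u v, B u → B v → ¬ Apart u v) (hτ : ∀ v ∈ τ, A v ∨ B v) : ¬ HasIndepTriple τ := by
  rintro ⟨x, hx, y, hy, z, hz, hxy, hxz, hyz⟩
  rcases hτ x hx with h1 | h1 <;> rcases hτ y hy with h2 | h2 <;> rcases hτ z hz with h3 | h3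
  · exact hA _ _ h1 h2 hxy
  · exact hA _ _ h1 h2 hxy
  · exact hA _ _ h1 h3 hxz
  · exact hB _ _ h2 h3 hyz
  · exact hA _ _ h2 h3 hyz
  · exact hB _ _ h1 h3 hxz
  · exact hB _ _ h1 h2 hxy
  · exact hB _ _ h1 h2 hxy

/-- The two colour classes of the grid are independent, and one of them meets a set of five vertices
in at least three. -/
theorem hasIndepTriple_of_card {n : ℕ} {τ : Finset (Fin 3 × Fin n)} (h : 5 ≤ τ.card) :
    HasIndepTriple τ := by
  have key : ∀ b : ℕ, 2 < (τ.filter fun v => ((v.1 : ℕ) + v.2) % 2 = b).card →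
      HasIndepTriple τ := by
    intro b hb
    obtain ⟨x, y, z, hx, hy, hz, hxy, hxz, hyz⟩ := Finset.two_lt_card_iff.1 hb
    rw [Finset.mem_filter] at hx hy hz
    have hap : ∀ u v : Fin 3 × Fin n, u ≠ v → ((u.1 : ℕ) + u.2) % 2 = b →
        ((v.1 : ℕ) + v.2) % 2 = b → Apart u v := by
      intro u v huv hu hv
      refine ⟨huv, fun hadj => ?_⟩
      rw [gridGraph_three_adj] at hadj
      omega
    exact ⟨x, hx.1, y, hy.1, z, hz.1, hap _ _ hxy hx.2 hy.2, hap _ _ hxz hx.2 hz.2,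
      hap _ _ hyz hy.2 hz.2⟩
  have hsum := Finset.card_filter_add_card_filter_not (s := τ)
    (fun v : Fin 3 × Fin n => ((v.1 : ℕ) + v.2) % 2 = 0)
  have hodd : (τ.filter fun v => ¬ ((v.1 : ℕ) + v.2) % 2 = 0) =
      τ.filter fun v => ((v.1 : ℕ) + v.2) % 2 = 1 :=
    Finset.filter_congr fun v _ => by omega
  rw [hodd] at hsum
  by_cases h0 : 2 < (τ.filter fun v => ((v.1 : ℕ) + v.2) % 2 = 0).card
  · exact key 0 h0
  · exact key 1 (by omega)

/-! ### A matching on the vertex sets outside the star -/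

theorem gridVertex_ext_iff {n : ℕ} {u v : Fin 3 × Fin n} :
    u = v ↔ (u.1 : ℕ) = v.1 ∧ (u.2 : ℕ) = v.2 := by
  rw [Prod.ext_iff, Fin.ext_iff, Fin.ext_iff]

/-- The left neighbour of a vertex; a vertex of the first column is its own left neighbour. -/
def leftNbr {n : ℕ} (v : Fin 3 × Fin n) : Fin 3 × Fin n := (v.1, ⟨(v.2 : ℕ) - 1, by omega⟩)

/-- The parent of a vertex in the spanning tree consisting of all rows and the first column, rooted
at the corner `(0, 0)`. The root is its own parent. -/
def parent {n : ℕ} (v : Fin 3 × Fin n) : Fin 3 × Fin n :=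
  if (v.2 : ℕ) = 0 then (⟨(v.1 : ℕ) - 1, by omega⟩, v.2) else leftNbr v

theorem leftNbr_fst {n : ℕ} (v : Fin 3 × Fin n) : ((leftNbr v).1 : ℕ) = v.1 := rfl

theorem leftNbr_snd {n : ℕ} (v : Fin 3 × Fin n) : ((leftNbr v).2 : ℕ) = v.2 - 1 := rfl

theorem parent_fst {n : ℕ} (v : Fin 3 × Fin n) :
    ((parent v).1 : ℕ) = if (v.2 : ℕ) = 0 then (v.1 : ℕ) - 1 else v.1 := by
  unfold parent
  split_ifs <;> rfl

theorem parent_snd {n : ℕ} (v : Fin 3 × Fin n) : ((parent v).2 : ℕ) = v.2 - 1 := by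
  unfold parent
  split_ifs with h
  · change (v.2 : ℕ) = _
    omega
  · rfl

/-- The corner of the grid. -/
def gridCorner (n : ℕ) [NeZero n] : Fin 3 × Fin n := (0, 0)

theorem gridCorner_fst (n : ℕ) [NeZero n] : ((gridCorner n).1 : ℕ) = 0 := rfl

theorem gridCorner_snd (n : ℕ) [NeZero n] : ((gridCorner n).2 : ℕ) = 0 := by
  simp [gridCorner]

/-- The sets `τ` for which the complement of `insert (gridCorner n) τ` is a face of the total cut
complex outside the star of the corner. -/
structure OffStar {n : ℕ} [NeZero n] (τ : Finset (Fin 3 × Fin n)) : Prop where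
  corner_notMem : gridCorner n ∉ τ
  not_indep : ¬ HasIndepTriple τ
  indep : HasIndepTriple (insert (gridCorner n) τ)

/-- `Toggles τ p` says that `τ` is matched by adding or removing `p`. The rule looks at the last
column `j` that `τ` meets. If this contains a single vertex of `τ`, then `p` is its left neighbour. If
it contains both ends, then `p` is the left neighbour of the first, unless the column is full and
the left neighbour of the other end is in `τ`. If it contains an edge of `τ` only, the rest of `τ`
has to be a vertex and possibly its parent `p`. -/
inductive Toggles {n : ℕ} (τ : Finset (Fin 3 × Fin n)) : Fin 3 × Fin n → Prop
  | single (j : Fin n) (r : Fin 3) (hj : ∀ v ∈ τ, v.2 ≤ j) (hr : (r, j) ∈ τ)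
      (h : ∀ r', (r', j) ∈ τ → r' = r) : Toggles τ (leftNbr (r, j))
  | ends (j : Fin n) (hj : ∀ v ∈ τ, v.2 ≤ j) (h0 : (0, j) ∈ τ) (h2 : (2, j) ∈ τ)
      (h : (1, j) ∈ τ → leftNbr (2, j) ∉ τ) : Toggles τ (leftNbr (0, j))
  | edge (j : Fin n) (hj : ∀ v ∈ τ, v.2 ≤ j) (h1 : (1, j) ∈ τ)
      (h : (0, j) ∈ τ ↔ (2, j) ∉ τ) (x : Fin 3 × Fin n) (hx : x ∈ τ) (hxj : x.2 < j)
      (hR : ∀ y ∈ τ, y.2 < j → y = x ∨ y = parent x) : Toggles τ (parent x)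

theorem HasIndepTriple.of_insert_single {n : ℕ} {θ : Finset (Fin 3 × Fin n)} {j : Fin n} {r : Fin 3}
    (hj : ∀ v ∈ θ, v.2 ≤ j) (hr : (r, j) ∈ θ) (h : ∀ r', (r', j) ∈ θ → r' = r)
    (hi : HasIndepTriple (insert (leftNbr (r, j)) θ)) : HasIndepTriple θ := by
  refine hi.of_insert_of_adj hr ?_ ?_
  · rw [apart_iff, leftNbr_fst, leftNbr_snd]
    simp only [true_and]
    omega
  · rintro ⟨a, b⟩ hv hadj
    have hb := Fin.le_def.1 (hj _ hv)
    rw [gridGraph_three_adj] at hadj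
    rw [gridVertex_ext_iff, leftNbr_fst, leftNbr_snd]
    simp only at hadj hb ⊢
    by_cases hbj : b = j
    · subst hbj
      have := h a hv
      omega
    · have : (b : ℕ) ≠ j := fun h => hbj (Fin.ext h)
      omega

theorem HasIndepTriple.of_insert_ends {n : ℕ} {θ : Finset (Fin 3 × Fin n)} {j : Fin n}
    (hj0 : 0 < (j : ℕ)) (hj : ∀ v ∈ θ, v.2 ≤ j) (h0 : (0, j) ∈ θ) (h2 : (2, j) ∈ θ)
    (h : (1, j) ∈ θ → leftNbr (2, j) ∉ θ)
    (hi : HasIndepTriple (insert (leftNbr (0, j)) θ)) : HasIndepTriple θ := by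
  by_cases h1 : (1, j) ∈ θ
  · rcases hi.of_insert with hi | ⟨y, hy, z, hz, hpy, hpz, hyz⟩
    · exact hi
    · -- A vertex apart from `leftNbr (0, j)` and the middle of the column lies further left.
      have mid : ∀ z ∈ θ, Apart (leftNbr (0, j)) z → Apart (1, j) z → HasIndepTriple θ := by
        intro z hz hpz h1z
        have hzj := Fin.le_def.1 (hj z hz)
        have hz2 : z ≠ leftNbr (2, j) := fun h' => h h1 (h' ▸ hz)
        rw [Ne, gridVertex_ext_iff, leftNbr_fst, leftNbr_snd] at hz2
        rw [apart_iff, leftNbr_fst, leftNbr_snd] at hpz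
        rw [apart_iff] at h1z
        have := z.1.isLt
        refine ⟨(0, j), h0, (2, j), h2, z, hz, ?_, ?_, ?_⟩
        · rw [apart_iff]; simp
        · rw [apart_iff]
          simp only [Fin.val_zero, Fin.val_one, Fin.val_two] at *
          omega
        · rw [apart_iff]
          simp only [Fin.val_zero, Fin.val_one, Fin.val_two] at *
          omega
      by_cases hy1 : y = (1, j)
      · subst hy1
        exact mid z hz hpz hyz
      · by_cases hz1 : z = (1, j)
        · subst hz1
          exact mid y hy hpy hyz.symm
        · have key : ∀ v ∈ θ, v ≠ (1, j) → Apart (leftNbr (0, j)) v → Apart (0, j) v := by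
            intro v hv hv1 hpv
            have hvj := Fin.le_def.1 (hj v hv)
            rw [Ne, gridVertex_ext_iff] at hv1
            rw [apart_iff, leftNbr_fst, leftNbr_snd] at hpv
            rw [apart_iff]
            simp only [Fin.val_zero, Fin.val_one] at *
            omega
          exact ⟨(0, j), h0, y, hy, z, hz, key y hy hy1 hpy, key z hz hz1 hpz, hyz⟩
  · refine hi.of_insert_of_adj h0 ?_ ?_
    · rw [apart_iff, leftNbr_fst, leftNbr_snd]
      simp only [true_and]
      omega
    · rintro v hv hadj
      have hb := Fin.le_def.1 (hj _ hv)
      have hv1 : v ≠ (1, j) := fun h => h1 (h ▸ hv)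
      rw [gridGraph_three_adj] at hadj
      rw [Ne, gridVertex_ext_iff] at hv1
      rw [gridVertex_ext_iff, leftNbr_fst, leftNbr_snd]
      simp only [Fin.val_zero, Fin.val_one] at *
      omega

theorem OffStar.pos_of_le {n : ℕ} [NeZero n] {τ : Finset (Fin 3 × Fin n)} (hτ : OffStar τ)
    {j : Fin n} (hj : ∀ v ∈ τ, v.2 ≤ j) : 0 < (j : ℕ) := by
  by_contra h0
  refine not_hasIndepTriple_of_cover (fun v => (v.2 : ℕ) = 0 ∧ (v.1 : ℕ) ≤ 1)
    (fun v => (v.2 : ℕ) = 0 ∧ (v.1 : ℕ) = 2) ?_ ?_ ?_ hτ.indep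
  · intro u v hu hv
    rw [apart_iff]
    omega
  · intro u v hu hv
    rw [apart_iff]
    omega
  · intro v hv
    rcases Finset.mem_insert.1 hv with rfl | hv
    · exact Or.inl ⟨gridCorner_snd n, by rw [gridCorner_fst]; omega⟩
    · have := Fin.le_def.1 (hj v hv)
      have := v.1.isLt
      omega

/-- A toggled vertex lies to the left of the last column. -/
theorem OffStar.exists_toggle_lt {n : ℕ} [NeZero n] {τ : Finset (Fin 3 × Fin n)} (hτ : OffStar τ)
    {p : Fin 3 × Fin n} (hp : Toggles τ p) : ∃ v ∈ τ, (p.2 : ℕ) < v.2 := by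
  rcases hp with ⟨j, r, hj, hr, -⟩ | ⟨j, hj, h0, -, -⟩ | ⟨j, hj, h1, -, x, -, hxj, -⟩
  · have := hτ.pos_of_le hj
    exact ⟨_, hr, by rw [leftNbr_snd]; simp only; omega⟩
  · have := hτ.pos_of_le hj
    exact ⟨_, h0, by rw [leftNbr_snd]; simp only; omega⟩
  · exact ⟨_, h1, by rw [parent_snd]; have := Fin.lt_def.1 hxj; simp only; omega⟩

/-- A column edge of `τ` together with a vertex and its parent is a union of two cliques. -/
theorem not_hasIndepTriple_of_edge {n : ℕ} {θ : Finset (Fin 3 × Fin n)} {j : Fin n}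
    (hj : ∀ v ∈ θ, v.2 ≤ j) (h : (0, j) ∈ θ → (2, j) ∉ θ) (x : Fin 3 × Fin n)
    (hR : ∀ y ∈ θ, y.2 < j → y = x ∨ y = parent x) : ¬ HasIndepTriple θ := by
  have hcol : ∀ v ∈ θ, v.2 = j → v = (0, j) ∨ v = (1, j) ∨ v = (2, j) := by
    rintro ⟨a, b⟩ - rfl
    fin_cases a <;> simp
  obtain ⟨q, hq⟩ : ∃ q : Fin 3, (q = 0 ∨ q = 2) ∧ (q, j) ∉ θ := by
    by_cases h0 : (0, j) ∈ θ
    · exact ⟨2, Or.inr rfl, h h0⟩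
    · exact ⟨0, Or.inl rfl, h0⟩
  refine not_hasIndepTriple_of_cover (fun v => v.2 = j ∧ v.1 ≠ q)
    (fun v => v = x ∨ v = parent x) ?_ ?_ ?_
  · rintro u v ⟨hu, hu'⟩ ⟨hv, hv'⟩
    have := u.1.isLt
    have := v.1.isLt
    rw [apart_iff, hu, hv]
    rw [Ne, Fin.ext_iff] at hu' hv'
    rcases hq.1 with rfl | rfl <;> simp only [Fin.val_zero, Fin.val_two] at hu' hv' <;> omega
  · have h1 := parent_fst x
    have h2 := parent_snd x
    rintro u v (rfl | rfl) (rfl | rfl) <;> rw [apart_iff] <;> split_ifs at h1 <;> omega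
  · intro v hv
    by_cases hvj : v.2 = j
    · refine Or.inl ⟨hvj, ?_⟩
      rintro rfl
      exact hq.2 (hvj ▸ hv)
    · exact Or.inr (hR v hv (lt_of_le_of_ne (hj v hv) hvj))

theorem apart_corner_of_parent_ne {n : ℕ} [NeZero n] {x : Fin 3 × Fin n}
    (hp : parent x ≠ gridCorner n) : Apart (gridCorner n) x := by
  rw [Ne, gridVertex_ext_iff, gridCorner_fst, gridCorner_snd, parent_fst, parent_snd] at hp
  rw [apart_iff, gridCorner_fst, gridCorner_snd]
  split_ifs at hp <;> omega

/-- Some vertex of a column edge is apart from both of two vertices further left that are apart. -/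
theorem hasIndepTriple_of_edge {n : ℕ} {θ : Finset (Fin 3 × Fin n)} {j : Fin n}
    (h1 : (1, j) ∈ θ) (h : (0, j) ∈ θ ∨ (2, j) ∈ θ) {c x : Fin 3 × Fin n} (hc : c ∈ θ)
    (hcj : c.2 < j) (hx : x ∈ θ) (hxj : x.2 < j) (hax : Apart c x) : HasIndepTriple θ := by
  have hxj := Fin.lt_def.1 hxj
  have hcj := Fin.lt_def.1 hcj
  obtain ⟨q, hq, hqθ⟩ : ∃ q : Fin 3, (q = 0 ∨ q = 2) ∧ (q, j) ∈ θ := by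
    rcases h with h | h
    · exact ⟨0, Or.inl rfl, h⟩
    · exact ⟨2, Or.inr rfl, h⟩
  have hq' : (q : ℕ) = 0 ∨ (q : ℕ) = 2 := by rcases hq with rfl | rfl <;> simp
  have hax' := hax
  rw [apart_iff] at hax'
  by_cases hm : Apart c (1, j) ∧ Apart x (1, j)
  · exact ⟨_, hc, x, hx, _, h1, hax, hm.1, hm.2⟩
  · refine ⟨_, hc, x, hx, _, hqθ, hax, ?_, ?_⟩
    · rw [apart_iff, apart_iff] at hm
      rw [apart_iff]
      simp only [Fin.val_one] at *
      omega
    · rw [apart_iff, apart_iff] at hm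
      rw [apart_iff]
      simp only [Fin.val_one] at *
      omega

theorem OffStar.toggle_ne_corner {n : ℕ} [NeZero n] {τ : Finset (Fin 3 × Fin n)} (hτ : OffStar τ)
    {p : Fin 3 × Fin n} (hp : Toggles τ p) : p ≠ gridCorner n := by
  rintro rfl
  generalize hq : gridCorner n = q at hp
  have hi := hτ.indep
  rcases hp with ⟨j, r, hj, hr, h⟩ | ⟨j, hj, h0, h2, h⟩ | ⟨j, hj, h1, h, x, hx, hxj, hR⟩
  · rw [hq] at hi
    exact hτ.not_indep (hi.of_insert_single hj hr h)
  · rw [hq] at hi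
    exact hτ.not_indep (hi.of_insert_ends (hτ.pos_of_le hj) hj h0 h2 h)
  · have hc := Fin.le_def.2 ((gridCorner_snd n).le.trans (Nat.zero_le (j : ℕ)))
    have hj0 := hτ.pos_of_le hj
    have hne : ∀ r, (r, j) ≠ gridCorner n := by
      intro r hr
      rw [gridVertex_ext_iff, gridCorner_snd] at hr
      simp only at hr
      omega
    refine not_hasIndepTriple_of_edge (j := j) (x := x) ?_ ?_ ?_ hi
    · intro v hv
      rcases Finset.mem_insert.1 hv with rfl | hv
      · exact hc
      · exact hj v hv
    · intro h0 h2
      exact h.1 ((Finset.mem_insert.1 h0).resolve_left (hne 0))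
        ((Finset.mem_insert.1 h2).resolve_left (hne 2))
    · intro y hy hyj
      rcases Finset.mem_insert.1 hy with rfl | hy
      · exact Or.inr hq
      · exact hR y hy hyj

theorem OffStar.not_indep_insert {n : ℕ} [NeZero n] {τ : Finset (Fin 3 × Fin n)} (hτ : OffStar τ)
    {p : Fin 3 × Fin n} (hp : Toggles τ p) : ¬ HasIndepTriple (insert p τ) := by
  intro hi
  have hlt := hτ.exists_toggle_lt hp
  rcases hp with ⟨j, r, hj, hr, h⟩ | ⟨j, hj, h0, h2, h⟩ | ⟨j, hj, h1, h, x, hx, hxj, hR⟩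
  · exact hτ.not_indep (hi.of_insert_single hj hr h)
  · exact hτ.not_indep (hi.of_insert_ends (hτ.pos_of_le hj) hj h0 h2 h)
  · have hpj : parent x ≠ (2, j) ∧ parent x ≠ (0, j) := by
      have := Fin.lt_def.1 hxj
      constructor <;> intro h <;> rw [gridVertex_ext_iff, parent_snd] at h <;> simp only at h <;>
        omega
    refine not_hasIndepTriple_of_edge (j := j) (x := x) ?_ ?_ ?_ hi
    · obtain ⟨w, hw, hlt⟩ := hlt
      intro v hv
      rcases Finset.mem_insert.1 hv with rfl | hv
      · exact Fin.le_def.2 (hlt.le.trans (Fin.le_def.1 (hj w hw)))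
      · exact hj v hv
    · intro h0 h2
      exact h.1 ((Finset.mem_insert.1 h0).resolve_left hpj.2.symm)
        ((Finset.mem_insert.1 h2).resolve_left hpj.1.symm)
    · intro y hy hyj
      rcases Finset.mem_insert.1 hy with rfl | hy
      · exact Or.inr rfl
      · exact hR y hy hyj

theorem OffStar.insert_toggle {n : ℕ} [NeZero n] {τ : Finset (Fin 3 × Fin n)} (hτ : OffStar τ)
    {p : Fin 3 × Fin n} (hp : Toggles τ p) : OffStar (insert p τ) where
  corner_notMem h := (Finset.mem_insert.1 h).elim (fun h => hτ.toggle_ne_corner hp h.symm)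
    hτ.corner_notMem
  not_indep := hτ.not_indep_insert hp
  indep := hτ.indep.mono (Finset.insert_subset_insert _ (Finset.subset_insert _ _))

theorem OffStar.erase_toggle {n : ℕ} [NeZero n] {τ : Finset (Fin 3 × Fin n)} (hτ : OffStar τ)
    {p : Fin 3 × Fin n} (hp : Toggles τ p) (hpτ : p ∈ τ) : OffStar (τ.erase p) where
  corner_notMem h := hτ.corner_notMem (Finset.mem_of_mem_erase h)
  not_indep h := hτ.not_indep (h.mono (Finset.erase_subset _ _))
  indep := by
    have hne := hτ.toggle_ne_corner hp
    have hlt := hτ.exists_toggle_lt hp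
    have hi : HasIndepTriple (insert p (insert (gridCorner n) (τ.erase p))) := by
      rw [Finset.insert_comm, Finset.insert_erase hpτ]
      exact hτ.indep
    have hc2 := gridCorner_snd n
    have hle : ∀ j : Fin n, (∀ v ∈ τ, v.2 ≤ j) →
        ∀ v ∈ insert (gridCorner n) (τ.erase p), v.2 ≤ j := by
      intro j hj v hv
      rcases Finset.mem_insert.1 hv with rfl | hv
      · exact Fin.le_def.2 (by omega)
      · exact hj v (Finset.mem_of_mem_erase hv)
    have hcol : ∀ j : Fin n, (∀ v ∈ τ, v.2 ≤ j) → ∀ r : Fin 3,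
        (r, j) ∈ insert (gridCorner n) (τ.erase p) ↔ (r, j) ∈ τ := by
      intro j hj r
      have hj0 := hτ.pos_of_le hj
      obtain ⟨w, hw, hlt⟩ := hlt
      have hwj := Fin.le_def.1 (hj w hw)
      have h1 : (r, j) ≠ gridCorner n := by
        rw [Ne, gridVertex_ext_iff, gridCorner_snd]
        simp only
        omega
      have h2 : (r, j) ≠ p := by
        rw [Ne, gridVertex_ext_iff]
        simp only
        omega
      rw [Finset.mem_insert, Finset.mem_erase]
      tauto
    rcases hp with ⟨j, r, hj, hr, h⟩ | ⟨j, hj, h0, h2, h⟩ | ⟨j, hj, h1, h, x, hx, hxj, hR⟩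
    · exact hi.of_insert_single (hle j hj) ((hcol j hj r).2 hr)
        fun r' hr' => h r' ((hcol j hj r').1 hr')
    · refine hi.of_insert_ends (hτ.pos_of_le hj) (hle j hj) ((hcol j hj 0).2 h0)
        ((hcol j hj 2).2 h2) fun h1 h' => ?_
      rcases Finset.mem_insert.1 h' with h' | h'
      · rw [gridVertex_ext_iff, gridCorner_fst, leftNbr_fst] at h'
        exact absurd h'.1 (by simp)
      · exact h ((hcol j hj 1).1 h1) (Finset.mem_of_mem_erase h')
    · have hxp : x ≠ parent x := by
        intro h'
        rw [gridVertex_ext_iff, parent_fst, parent_snd] at h'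
        rw [Ne, gridVertex_ext_iff, gridCorner_fst, gridCorner_snd, parent_fst, parent_snd] at hne
        split_ifs at h' hne <;> omega
      refine hasIndepTriple_of_edge ((hcol j hj 1).2 h1) ?_ (Finset.mem_insert_self _ _)
        (Fin.lt_def.2 (by rw [hc2]; exact hτ.pos_of_le hj))
        (Finset.mem_insert_of_mem (Finset.mem_erase.2 ⟨hxp, hx⟩)) hxj
        (apart_corner_of_parent_ne hne)
      rw [hcol j hj, hcol j hj]
      tauto

/-- Adding or removing the toggled vertex does not change which vertex is toggled. -/
theorem OffStar.toggles_congr {n : ℕ} [NeZero n] {τ : Finset (Fin 3 × Fin n)} (hτ : OffStar τ)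
    {p : Fin 3 × Fin n} (hp : Toggles τ p) {τ' : Finset (Fin 3 × Fin n)}
    (h' : ∀ v, v ≠ p → (v ∈ τ' ↔ v ∈ τ)) : Toggles τ' p := by
  have hne := hτ.toggle_ne_corner hp
  obtain ⟨w, hw, hlt⟩ := hτ.exists_toggle_lt hp
  have hle : ∀ j : Fin n, (∀ v ∈ τ, v.2 ≤ j) → ∀ v ∈ τ', v.2 ≤ j := by
    intro j hj v hv
    by_cases hvp : v = p
    · subst hvp
      exact Fin.le_def.2 (hlt.le.trans (Fin.le_def.1 (hj w hw)))
    · exact hj v ((h' v hvp).1 hv)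
  have hcol : ∀ j : Fin n, (∀ v ∈ τ, v.2 ≤ j) → ∀ r : Fin 3, (r, j) ∈ τ' ↔ (r, j) ∈ τ := by
    intro j hj r
    refine h' _ fun h => ?_
    have hwj := Fin.le_def.1 (hj w hw)
    rw [gridVertex_ext_iff] at h
    simp only at h
    omega
  rcases hp with ⟨j, r, hj, hr, h⟩ | ⟨j, hj, h0, h2, h⟩ | ⟨j, hj, h1, h, x, hx, hxj, hR⟩
  · exact .single j r (hle j hj) ((hcol j hj r).2 hr) fun r' hr' => h r' ((hcol j hj r').1 hr')
  · refine .ends j (hle j hj) ((hcol j hj 0).2 h0) ((hcol j hj 2).2 h2) fun h1 hmem => ?_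
    refine h ((hcol j hj 1).1 h1) ((h' _ fun heq => ?_).1 hmem)
    rw [gridVertex_ext_iff, leftNbr_fst, leftNbr_fst] at heq
    exact absurd heq.1 (by simp)
  · have hxp : x ≠ parent x := by
      intro h'
      rw [gridVertex_ext_iff, parent_fst, parent_snd] at h'
      rw [Ne, gridVertex_ext_iff, gridCorner_fst, gridCorner_snd, parent_fst, parent_snd] at hne
      split_ifs at h' hne <;> omega
    refine .edge j (hle j hj) ((hcol j hj 1).2 h1) (by rw [hcol j hj, hcol j hj]; exact h) x
      ((h' x hxp).2 hx) hxj fun y hy hyj => ?_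
    by_cases hyp : y = parent x
    · exact Or.inr hyp
    · exact hR y ((h' y hyp).1 hy) hyj

theorem Toggles.unique {n : ℕ} {τ : Finset (Fin 3 × Fin n)} {p q : Fin 3 × Fin n}
    (hp : Toggles τ p) (hq : Toggles τ q) : p = q := by
  have hjj : ∀ {j j' : Fin n} {r r' : Fin 3}, (∀ v ∈ τ, v.2 ≤ j) → (∀ v ∈ τ, v.2 ≤ j') →
      (r, j) ∈ τ → (r', j') ∈ τ → j' = j := fun h h' hr hr' => le_antisymm (h _ hr') (h' _ hr)
  rcases hp with ⟨j, r, hj, hr, h⟩ | ⟨j, hj, h0, h2, h⟩ | ⟨j, hj, h1, h, x, hx, hxj, hR⟩ <;>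
    rcases hq with ⟨j', r', hj', hr', h'⟩ | ⟨j', hj', h0', h2', h'⟩ |
      ⟨j', hj', h1', h', x', hx', hxj', hR'⟩
  · obtain rfl := hjj hj hj' hr hr'
    rw [h r' hr']
  · obtain rfl := hjj hj hj' hr h0'
    exact absurd ((h 0 h0').trans (h 2 h2').symm) (by decide)
  · obtain rfl := hjj hj hj' hr h1'
    by_cases h0 : (0, j') ∈ τ
    · exact absurd ((h 0 h0).trans (h 1 h1').symm) (by decide)
    · have h2 : (2, j') ∈ τ := by tauto
      exact absurd ((h 2 h2).trans (h 1 h1').symm) (by decide)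
  · obtain rfl := hjj hj hj' h0 hr'
    exact absurd ((h' 0 h0).trans (h' 2 h2).symm) (by decide)
  · obtain rfl := hjj hj hj' h0 h0'
    rfl
  · obtain rfl := hjj hj hj' h0 h1'
    tauto
  · obtain rfl := hjj hj hj' h1 hr'
    by_cases h0 : (0, j') ∈ τ
    · exact absurd ((h' 0 h0).trans (h' 1 h1).symm) (by decide)
    · have h2 : (2, j') ∈ τ := by tauto
      exact absurd ((h' 2 h2).trans (h' 1 h1).symm) (by decide)
  · obtain rfl := hjj hj hj' h1 h0'
    tauto
  · obtain rfl := hjj hj hj' h1 h1'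
    rcases hR x' hx' hxj' with rfl | hxx'
    · rfl
    · rcases hR' x hx hxj with rfl | hx'x
      · rfl
      · -- Each of `x`, `x'` is the parent of the other, so both are the root.
        have : x = x' := by
          rw [gridVertex_ext_iff, parent_fst, parent_snd] at hxx' hx'x
          rw [gridVertex_ext_iff]
          split_ifs at hxx' hx'x <;> omega
        rw [this]

/-- The position of a vertex in the column-by-column order. -/
def gridIndex {n : ℕ} (v : Fin 3 × Fin n) : ℕ := 3 * (v.2 : ℕ) + v.1

/-- If a vertex `x ≠ p` is removed from a matched set `τ ∋ p` and the resulting set is matched by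
adding `q`, then `q` precedes `x`. This makes the matching acyclic. -/
theorem OffStar.gridIndex_lt {n : ℕ} [NeZero n] {τ : Finset (Fin 3 × Fin n)} (hτ : OffStar τ)
    {p q x : Fin 3 × Fin n} (hp : Toggles τ p) (hpτ : p ∈ τ) (hx : x ∈ τ) (hxp : x ≠ p)
    (hτ' : OffStar (τ.erase x)) (hq : Toggles (τ.erase x) q) (hqx : q ∉ τ.erase x) :
    gridIndex q < gridIndex x := by
  have hpx : p ∈ τ.erase x := Finset.mem_erase.2 ⟨hxp.symm, hpτ⟩
  obtain ⟨w, hw, hqw⟩ := hτ'.exists_toggle_lt hq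
  have hwτ := Finset.mem_of_mem_erase hw
  by_cases hlast : ∀ v ∈ τ, v.2 ≤ x.2
  · have := Fin.le_def.1 (hlast w hwτ)
    have := q.1.isLt
    unfold gridIndex
    omega
  · -- The last column is unchanged, so `q = p` unless `τ` is matched along a tree edge.
    have hkeep : ∀ j : Fin n, (∀ v ∈ τ, v.2 ≤ j) → ∀ r : Fin 3, (r, j) ∈ τ.erase x ↔ (r, j) ∈ τ := by
      intro j hj r
      rw [Finset.mem_erase]
      refine and_iff_right fun h => hlast ?_
      rw [← h]
      exact hj
    have hle : ∀ j : Fin n, (∀ v ∈ τ, v.2 ≤ j) → ∀ v ∈ τ.erase x, v.2 ≤ j :=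
      fun j hj v hv => hj v (Finset.mem_of_mem_erase hv)
    rcases hp with ⟨j, r, hj, hr, h⟩ | ⟨j, hj, h0, h2, h⟩ | ⟨j, hj, h1, h, y, hy, hyj, hR⟩
    · have := Toggles.single j r (hle j hj) ((hkeep j hj r).2 hr)
        fun r' hr' => h r' ((hkeep j hj r').1 hr')
      exact absurd (hq.unique this ▸ hpx) hqx
    · have := Toggles.ends j (hle j hj) ((hkeep j hj 0).2 h0) ((hkeep j hj 2).2 h2)
        fun h1 h' => h ((hkeep j hj 1).1 h1) (Finset.mem_of_mem_erase h')
      exact absurd (hq.unique this ▸ hpx) hqx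
    · have hpj : (parent y).2 < j := by
        have := Fin.lt_def.1 hyj
        exact Fin.lt_def.2 (by rw [parent_snd]; omega)
      have hxj : x.2 < j := lt_of_le_of_ne (hj x hx) fun h => hlast (h ▸ hj)
      obtain rfl : x = y := (hR x hx hxj).resolve_right hxp
      have := Toggles.edge j (hle j hj) ((hkeep j hj 1).2 h1)
        (by rw [hkeep j hj, hkeep j hj]; exact h) (parent x) hpx hpj fun z hz hzj => by
          obtain ⟨hzx, hz⟩ := Finset.mem_erase.1 hz
          exact Or.inl ((hR z hz hzj).resolve_left hzx)
      rw [hq.unique this]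
      have hxc : x ≠ gridCorner n := fun h => hτ.corner_notMem (h ▸ hx)
      rw [Ne, gridVertex_ext_iff, gridCorner_fst, gridCorner_snd] at hxc
      unfold gridIndex
      have h1 := parent_fst (parent x)
      have h2 := parent_snd (parent x)
      have h3 := parent_fst x
      have h4 := parent_snd x
      have := x.1.isLt
      split_ifs at h1 h3 <;> omega

/-! ### The critical sets -/

/-- The vertices `k` and `k + 1` of column `i`, which form one of its two edges. -/
def colEdge {n : ℕ} (k : Fin 2) (i : Fin n) : Finset (Fin 3 × Fin n) :=
  {(k.castSucc, i), (k.succ, i)}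

theorem mem_colEdge {n : ℕ} {k : Fin 2} {i : Fin n} {v : Fin 3 × Fin n} :
    v ∈ colEdge k i ↔ (v.2 : ℕ) = i ∧ ((v.1 : ℕ) = k ∨ (v.1 : ℕ) = k + 1) := by
  simp only [colEdge, Finset.mem_insert, Finset.mem_singleton, gridVertex_ext_iff,
    Fin.val_castSucc, Fin.val_succ]
  tauto

/-- The set consisting of a column and the left neighbour of its last vertex. -/
def fullColumn {n : ℕ} (j : Fin n) : Finset (Fin 3 × Fin n) :=
  {(0, j), (1, j), (2, j), leftNbr (2, j)}

theorem mem_fullColumn {n : ℕ} {j : Fin n} {v : Fin 3 × Fin n} :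
    v ∈ fullColumn j ↔ (v.2 : ℕ) = j ∨ ((v.1 : ℕ) = 2 ∧ (v.2 : ℕ) = j - 1) := by
  have := v.1.isLt
  simp only [fullColumn, Finset.mem_insert, Finset.mem_singleton, gridVertex_ext_iff, leftNbr_fst,
    leftNbr_snd, Fin.val_zero, Fin.val_one, Fin.val_two]
  omega

/-- The sets that the matching leaves over. -/
def IsCritical {n : ℕ} [NeZero n] (τ : Finset (Fin 3 × Fin n)) : Prop :=
  OffStar τ ∧ ∀ p, ¬ Toggles τ p

theorem isCritical_fullColumn {n : ℕ} [NeZero n] {j : Fin n} (hj : 0 < (j : ℕ)) :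
    IsCritical (fullColumn j) := by
  have hc1 := gridCorner_fst n
  have hc2 := gridCorner_snd n
  have hle : ∀ v ∈ fullColumn j, v.2 ≤ j := fun v hv => by
    rw [mem_fullColumn] at hv
    exact Fin.le_def.2 (by omega)
  have hcol : ∀ r, (r, j) ∈ fullColumn j := fun r => mem_fullColumn.2 (Or.inl rfl)
  have hleft : leftNbr (2, j) ∈ fullColumn j := mem_fullColumn.2 (Or.inr ⟨rfl, rfl⟩)
  have hlast : ∀ j' : Fin n, (∀ v ∈ fullColumn j, v.2 ≤ j') → ∀ r, (r, j') ∈ fullColumn j →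
      j' = j := fun j' h r hr => le_antisymm (hle _ hr) (h _ (hcol 0))
  refine ⟨⟨?_, ?_, ?_⟩, ?_⟩
  · rw [mem_fullColumn]
    omega
  · refine not_hasIndepTriple_of_cover (fun v => (v.2 : ℕ) = j ∧ (v.1 : ℕ) ≤ 1)
      (fun v => (v.1 : ℕ) = 2 ∧ ((v.2 : ℕ) = j ∨ (v.2 : ℕ) = j - 1)) ?_ ?_ ?_
    · intro u v hu hv
      rw [apart_iff]
      omega
    · intro u v hu hv
      rw [apart_iff]
      omega
    · intro v hv
      have := v.1.isLt
      rw [mem_fullColumn] at hv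
      omega
  · refine ⟨_, Finset.mem_insert_self _ _, _, Finset.mem_insert_of_mem (hcol 1), _,
      Finset.mem_insert_of_mem hleft, ?_, ?_, ?_⟩ <;> rw [apart_iff] <;>
      simp only [leftNbr_fst, leftNbr_snd, Fin.val_one, Fin.val_two] <;> omega
  · rintro p (⟨j', r, hj', hr, h⟩ | ⟨j', hj', h0, h2, h⟩ | ⟨j', hj', h1, h, -⟩)
    · obtain rfl := hlast j' hj' r hr
      exact absurd ((h 0 (hcol 0)).trans (h 1 (hcol 1)).symm) (by decide)
    · obtain rfl := hlast j' hj' 0 h0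
      exact h (hcol 1) hleft
    · obtain rfl := hlast j' hj' 1 h1
      exact h.1 (hcol 0) (hcol 2)

theorem isCritical_colEdge_union {n : ℕ} [NeZero n] {i j : Fin n} (hi : 0 < (i : ℕ)) (hij : i < j)
    (k l : Fin 2) : IsCritical (colEdge k i ∪ colEdge l j) := by
  have hc1 := gridCorner_fst n
  have hc2 := gridCorner_snd n
  have hij := Fin.lt_def.1 hij
  have hk := k.isLt
  have hl := l.isLt
  have hmem : ∀ v : Fin 3 × Fin n, v ∈ colEdge k i ∪ colEdge l j ↔
      ((v.2 : ℕ) = i ∧ ((v.1 : ℕ) = k ∨ (v.1 : ℕ) = k + 1)) ∨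
      ((v.2 : ℕ) = j ∧ ((v.1 : ℕ) = l ∨ (v.1 : ℕ) = l + 1)) := fun v => by
    rw [Finset.mem_union, mem_colEdge, mem_colEdge]
  have hle : ∀ v ∈ colEdge k i ∪ colEdge l j, v.2 ≤ j := fun v hv => by
    rw [hmem] at hv
    exact Fin.le_def.2 (by omega)
  have hla : (l.castSucc, j) ∈ colEdge k i ∪ colEdge l j := (hmem _).2 (Or.inr ⟨rfl, Or.inl rfl⟩)
  have hlb : (l.succ, j) ∈ colEdge k i ∪ colEdge l j :=
    (hmem _).2 (Or.inr ⟨rfl, Or.inr (Fin.val_succ l)⟩)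
  have hka : (k.castSucc, i) ∈ colEdge k i ∪ colEdge l j := (hmem _).2 (Or.inl ⟨rfl, Or.inl rfl⟩)
  have hkb : (k.succ, i) ∈ colEdge k i ∪ colEdge l j :=
    (hmem _).2 (Or.inl ⟨rfl, Or.inr (Fin.val_succ k)⟩)
  have hlast : ∀ j' : Fin n, (∀ v ∈ colEdge k i ∪ colEdge l j, v.2 ≤ j') →
      ∀ r, (r, j') ∈ colEdge k i ∪ colEdge l j → j' = j :=
    fun j' h r hr => le_antisymm (hle _ hr) (h _ hla)
  refine ⟨⟨?_, ?_, ?_⟩, ?_⟩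
  · rw [hmem]
    omega
  · refine not_hasIndepTriple_of_cover (fun v => v ∈ colEdge k i) (fun v => v ∈ colEdge l j) ?_ ?_
      fun v hv => Finset.mem_union.1 hv
    · intro u v hu hv
      rw [mem_colEdge] at hu hv
      rw [apart_iff]
      omega
    · intro u v hu hv
      rw [mem_colEdge] at hu hv
      rw [apart_iff]
      omega
  · by_cases hlk : (l : ℕ) = k + 1
    · refine ⟨_, Finset.mem_insert_self _ _, _, Finset.mem_insert_of_mem hkb, _,
        Finset.mem_insert_of_mem hlb, ?_, ?_, ?_⟩ <;> rw [apart_iff] <;>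
        simp only [Fin.val_succ] <;> omega
    · refine ⟨_, Finset.mem_insert_self _ _, _, Finset.mem_insert_of_mem hkb, _,
        Finset.mem_insert_of_mem hla, ?_, ?_, ?_⟩ <;> rw [apart_iff] <;>
        simp only [Fin.val_succ, Fin.val_castSucc] <;> omega
  · rintro p (⟨j', r, hj', hr, h⟩ | ⟨j', hj', h0, h2, -⟩ | ⟨j', hj', h1, -, x, hx, hxj, hR⟩)
    · obtain rfl := hlast j' hj' r hr
      have := Fin.ext_iff.1 ((h _ hla).trans (h _ hlb).symm)
      rw [Fin.val_succ, Fin.val_castSucc] at this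
      omega
    · obtain rfl := hlast j' hj' 0 h0
      rw [hmem] at h0 h2
      simp only [Fin.val_zero, Fin.val_two] at h0 h2
      omega
    · obtain rfl := hlast j' hj' 1 h1
      have hxj := Fin.lt_def.1 hxj
      have ha := hR _ hka (Fin.lt_def.2 hij)
      have hb := hR _ hkb (Fin.lt_def.2 hij)
      rw [hmem] at hx
      simp only [gridVertex_ext_iff, parent_snd, Fin.val_castSucc, Fin.val_succ] at ha hb
      omega

theorem IsCritical.eq_fullColumn_or {n : ℕ} [NeZero n] {τ : Finset (Fin 3 × Fin n)}
    (hτ : IsCritical τ) : (∃ j : Fin n, 0 < (j : ℕ) ∧ τ = fullColumn j) ∨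
      ∃ i j : Fin n, ∃ k l : Fin 2, 0 < (i : ℕ) ∧ i < j ∧ τ = colEdge k i ∪ colEdge l j := by
  obtain ⟨hτ, hT⟩ := hτ
  have hne : τ.Nonempty := by
    by_contra h
    rw [Finset.not_nonempty_iff_eq_empty] at h
    subst h
    refine not_hasIndepTriple_of_cover (fun v => v = gridCorner n) (fun v => v = gridCorner n)
      ?_ ?_ ?_ hτ.indep
    · rintro u v rfl rfl h
      exact h.1 rfl
    · rintro u v rfl rfl h
      exact h.1 rfl
    · intro v hv
      simpa using hv
  obtain ⟨w, hw, hmax⟩ := τ.exists_max_image (fun v => v.2) hne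
  obtain ⟨j, hjw⟩ : ∃ j, j = w.2 := ⟨_, rfl⟩
  have hj : ∀ v ∈ τ, v.2 ≤ j := fun v hv => hjw ▸ hmax v hv
  have hj0 := hτ.pos_of_le hj
  have hcol : ∀ v : Fin 3 × Fin n, v.2 = j → v = (0, j) ∨ v = (1, j) ∨ v = (2, j) := by
    rintro ⟨a, b⟩ rfl
    fin_cases a <;> simp
  have hw' := hcol w hjw.symm
  have hfin : ∀ r : Fin 3, r = 0 ∨ r = 1 ∨ r = 2 := by decide
  by_cases h1 : (1, j) ∈ τ
  · by_cases h02 : (0, j) ∈ τ ↔ (2, j) ∉ τ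
    · -- The rest of `τ` is pairwise adjacent, but not of the form vertex and parent.
      right
      have hclique : ∀ u ∈ τ, u.2 < j → ∀ v ∈ τ, v.2 < j → ¬ Apart u v := by
        intro u hu huj v hv hvj h
        exact hτ.not_indep (hasIndepTriple_of_edge h1 (by tauto) hu huj hv hvj h)
      have hR : ∀ x ∈ τ, x.2 < j → ∃ y ∈ τ, y.2 < j ∧ y ≠ x ∧ y ≠ parent x := by
        intro x hx hxj
        by_contra hcon
        push Not at hcon
        refine hT _ (.edge j hj h1 h02 x hx hxj fun y hy hyj => ?_)
        by_cases hyx : y = x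
        · exact Or.inl hyx
        · exact Or.inr (hcon y hy hyj hyx)
      obtain ⟨x, hx, hxj⟩ : ∃ x ∈ τ, x.2 < j := by
        by_contra hcon
        push Not at hcon
        have hcr : ∀ r, (r, j) ≠ gridCorner n := by
          intro r hr
          rw [gridVertex_ext_iff, gridCorner_snd] at hr
          simp only at hr
          omega
        refine not_hasIndepTriple_of_edge (j := j) (x := gridCorner n) ?_ ?_ ?_ hτ.indep
        · intro v hv
          rcases Finset.mem_insert.1 hv with rfl | hv
          · exact Fin.le_def.2 (by rw [gridCorner_snd]; omega)
          · exact hj v hv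
        · intro h0 h2
          exact h02.1 ((Finset.mem_insert.1 h0).resolve_left (hcr 0))
            ((Finset.mem_insert.1 h2).resolve_left (hcr 2))
        · intro y hy hyj
          rcases Finset.mem_insert.1 hy with rfl | hy
          · exact Or.inl rfl
          · exact absurd hyj (not_lt.2 (hcon y hy))
      obtain ⟨y, hy, hyj, hyx, hyp⟩ := hR x hx hxj
      have hxy := hclique x hx hxj y hy hyj
      -- The grid has no triangles.
      have htri : ∀ z ∈ τ, z.2 < j → z = x ∨ z = y := by
        intro z hz hzj
        have hxz := hclique x hx hxj z hz hzj
        have hyz := hclique y hy hyj z hz hzj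
        rw [apart_iff] at hxy hxz hyz
        rw [Ne, gridVertex_ext_iff] at hyx
        rw [gridVertex_ext_iff, gridVertex_ext_iff]
        omega
      have hxp : x ≠ parent y := by
        obtain ⟨z, hz, hzj, hzy, hzp⟩ := hR y hy hyj
        rcases htri z hz hzj with rfl | rfl
        · exact hzp
        · exact absurd rfl hzy
      have hvert : (x.2 : ℕ) = y.2 ∧ 0 < (x.2 : ℕ) ∧
          ((x.1 : ℕ) + 1 = y.1 ∨ (y.1 : ℕ) + 1 = x.1) := by
        rw [apart_iff] at hxy
        rw [Ne, gridVertex_ext_iff] at hyx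
        rw [Ne, gridVertex_ext_iff, parent_fst, parent_snd] at hyp hxp
        split_ifs at hyp hxp <;> omega
      have hk : ∃ k : Fin 2, ∀ v, v ∈ colEdge k x.2 ↔ v = x ∨ v = y := by
        have := x.1.isLt
        have := y.1.isLt
        refine ⟨⟨min x.1 y.1, by omega⟩, fun v => ?_⟩
        rw [mem_colEdge, gridVertex_ext_iff, gridVertex_ext_iff]
        simp only
        omega
      have hl : ∃ l : Fin 2, ∀ r, (r, j) ∈ colEdge l j ↔ (r, j) ∈ τ := by
        by_cases h0 : (0, j) ∈ τ
        · refine ⟨0, fun r => ?_⟩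
          have h2 := h02.1 h0
          rcases hfin r with rfl | rfl | rfl <;> simp [mem_colEdge, h0, h1, h2]
        · refine ⟨1, fun r => ?_⟩
          have h2 : (2, j) ∈ τ := by tauto
          rcases hfin r with rfl | rfl | rfl <;> simp [mem_colEdge, h0, h1, h2]
      obtain ⟨k, hk⟩ := hk
      obtain ⟨l, hl⟩ := hl
      refine ⟨x.2, j, k, l, hvert.2.1, hxj, ?_⟩
      ext v
      rw [Finset.mem_union, hk]
      constructor
      · intro hv
        by_cases hvj : v.2 = j
        · right
          obtain ⟨a, b⟩ := v
          simp only at hvj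
          subst hvj
          exact (hl a).2 hv
        · exact Or.inl (htri v hv (lt_of_le_of_ne (hj v hv) hvj))
      · rintro ((rfl | rfl) | hv)
        · exact hx
        · exact hy
        · have hvj := Fin.ext (mem_colEdge.1 hv).1
          obtain ⟨a, b⟩ := v
          simp only at hvj
          subst hvj
          exact (hl a).1 hv
    · by_cases h0 : (0, j) ∈ τ
      · have h2 : (2, j) ∈ τ := by tauto
        have hleft : leftNbr (2, j) ∈ τ := by
          by_contra h
          exact hT _ (.ends j hj h0 h2 fun _ => h)
        refine Or.inl ⟨j, hj0, ?_⟩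
        ext v
        constructor
        · intro hv
          by_contra hnv
          rw [mem_fullColumn] at hnv
          have hvj := Fin.le_def.1 (hj v hv)
          have := v.1.isLt
          by_cases hv0 : Apart (0, j) v
          · refine hτ.not_indep ⟨_, h0, _, h2, v, hv, ?_, hv0, ?_⟩
            · rw [apart_iff]
              simp
            · rw [apart_iff] at hv0 ⊢
              simp only [Fin.val_zero, Fin.val_two] at *
              omega
          · refine hτ.not_indep ⟨_, h1, _, hleft, v, hv, ?_, ?_, ?_⟩ <;>
              rw [apart_iff] at hv0 ⊢ <;>
              simp only [leftNbr_fst, leftNbr_snd, Fin.val_zero, Fin.val_one, Fin.val_two] at * <;>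
              omega
        · simp only [fullColumn, Finset.mem_insert, Finset.mem_singleton]
          rintro (rfl | rfl | rfl | rfl) <;> assumption
      · have h2 : (2, j) ∉ τ := by tauto
        refine absurd (Toggles.single j 1 hj h1 fun r hr => ?_) (hT _)
        rcases hfin r with rfl | rfl | rfl
        · exact absurd hr h0
        · rfl
        · exact absurd hr h2
  · exfalso
    by_cases h0 : (0, j) ∈ τ
    · by_cases h2 : (2, j) ∈ τ
      · exact hT _ (.ends j hj h0 h2 fun h => absurd h h1)
      · refine hT _ (Toggles.single j 0 hj h0 fun r hr => ?_)
        rcases hfin r with rfl | rfl | rfl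
        · rfl
        · exact absurd hr h1
        · exact absurd hr h2
    · have h2 : (2, j) ∈ τ := by
        rcases hw' with h | h | h
        · exact absurd (h ▸ hw) h0
        · exact absurd (h ▸ hw) h1
        · exact h ▸ hw
      refine hT _ (Toggles.single j 2 hj h2 fun r hr => ?_)
      rcases hfin r with rfl | rfl | rfl
      · exact absurd hr h0
      · exact absurd hr h1
      · rfl

open Classical in
/-- The set of critical sets. -/
noncomputable def criticalSets (n : ℕ) [NeZero n] : Finset (Finset (Fin 3 × Fin n)) :=
  Finset.univ.filter IsCritical

theorem mem_criticalSets {n : ℕ} [NeZero n] {τ : Finset (Fin 3 × Fin n)} :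
    τ ∈ criticalSets n ↔ IsCritical τ := by
  simp [criticalSets]

theorem choose_two_double (m : ℕ) : m + 4 * m.choose 2 = (2 * m).choose 2 := by
  induction m with
  | zero => rfl
  | succ m ih =>
    have h1 : (m + 1).choose 2 = m + m.choose 2 := by
      rw [Nat.choose_succ_succ' m 1, Nat.choose_one_right]
    have h2 : (2 * (m + 1)).choose 2 = (2 * m + 1) + (2 * m + (2 * m).choose 2) := by
      rw [show 2 * (m + 1) = (2 * m + 1) + 1 by ring, Nat.choose_succ_succ' (2 * m + 1) 1,
        Nat.choose_succ_succ' (2 * m) 1, Nat.choose_one_right, Nat.choose_one_right]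
    omega

theorem sum_pred_fin (n : ℕ) : ∑ j : Fin n, ((j : ℕ) - 1) = (n - 1).choose 2 := by
  rw [Fin.sum_univ_eq_sum_range (fun j => j - 1)]
  cases n with
  | zero => rfl
  | succ m =>
    rw [Finset.sum_range_succ', Nat.choose_two_right, ← Finset.sum_range_id]
    simp

theorem fullColumn_injective {n : ℕ} : Function.Injective (fullColumn (n := n)) := by
  intro j j' h
  have h1 : ((0 : Fin 3), j) ∈ fullColumn j' := h ▸ mem_fullColumn.2 (Or.inl rfl)
  rw [mem_fullColumn] at h1
  simp only [Fin.val_zero] at h1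
  exact Fin.ext (by omega)

theorem colEdge_union_injective {n : ℕ} {i j i' j' : Fin n} {k l k' l' : Fin 2} (hij : i < j)
    (hij' : i' < j') (h : colEdge k i ∪ colEdge l j = colEdge k' i' ∪ colEdge l' j') :
    i = i' ∧ j = j' ∧ k = k' ∧ l = l' := by
  have hij := Fin.lt_def.1 hij
  have hij' := Fin.lt_def.1 hij'
  have hmem : ∀ v : Fin 3 × Fin n, (((v.2 : ℕ) = i ∧ ((v.1 : ℕ) = k ∨ (v.1 : ℕ) = k + 1)) ∨
      ((v.2 : ℕ) = j ∧ ((v.1 : ℕ) = l ∨ (v.1 : ℕ) = l + 1))) ↔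
      (((v.2 : ℕ) = i' ∧ ((v.1 : ℕ) = k' ∨ (v.1 : ℕ) = k' + 1)) ∨
      ((v.2 : ℕ) = j' ∧ ((v.1 : ℕ) = l' ∨ (v.1 : ℕ) = l' + 1))) := fun v => by
    rw [← mem_colEdge, ← mem_colEdge, ← mem_colEdge, ← mem_colEdge, ← Finset.mem_union,
      ← Finset.mem_union, h]
  have a1 := (hmem (k.castSucc, i)).1 (Or.inl ⟨rfl, Or.inl rfl⟩)
  have a2 := (hmem (k.succ, i)).1 (Or.inl ⟨rfl, Or.inr (Fin.val_succ k)⟩)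
  have a3 := (hmem (l.castSucc, j)).1 (Or.inr ⟨rfl, Or.inl rfl⟩)
  have a4 := (hmem (l.succ, j)).1 (Or.inr ⟨rfl, Or.inr (Fin.val_succ l)⟩)
  have b3 := (hmem (l'.castSucc, j')).2 (Or.inr ⟨rfl, Or.inl rfl⟩)
  have b1 := (hmem (k'.castSucc, i')).2 (Or.inl ⟨rfl, Or.inl rfl⟩)
  simp only [Fin.val_castSucc, Fin.val_succ] at a1 a2 a3 a4 b1 b3
  have hj : (j : ℕ) = j' := by omega
  have hi : (i : ℕ) = i' := by omega
  refine ⟨Fin.ext hi, Fin.ext hj, Fin.ext ?_, Fin.ext ?_⟩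
  · clear a3 a4 b1 b3
    omega
  · clear a1 a2 b1 b3
    omega

theorem fullColumn_ne {n : ℕ} {i j j' : Fin n} {k l : Fin 2} (hij : i < j) :
    fullColumn j' ≠ colEdge k i ∪ colEdge l j := by
  intro h
  have hij := Fin.lt_def.1 hij
  have hcol : ∀ r : Fin 3, (((j' : ℕ) = i ∧ ((r : ℕ) = k ∨ (r : ℕ) = k + 1)) ∨
      ((j' : ℕ) = j ∧ ((r : ℕ) = l ∨ (r : ℕ) = l + 1))) := fun r => by
    have : (r, j') ∈ colEdge k i ∪ colEdge l j := h ▸ mem_fullColumn.2 (Or.inl rfl)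
    rwa [Finset.mem_union, mem_colEdge, mem_colEdge] at this
  have h0 := hcol 0
  have h1 := hcol 1
  have h2 := hcol 2
  simp only [Fin.val_zero, Fin.val_one, Fin.val_two] at h0 h1 h2
  omega

theorem card_criticalSets (n : ℕ) [NeZero n] : (criticalSets n).card = (2 * n - 2).choose 2 := by
  classical
  let A : Finset (Finset (Fin 3 × Fin n)) := (Finset.Ioi (0 : Fin n)).image fullColumn
  let S : Finset ((Σ _ : Fin n, Fin n) × (Fin 2 × Fin 2)) :=
    (Finset.univ.sigma fun j : Fin n => Finset.Ioo 0 j) ×ˢ Finset.univ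
  let f : (Σ _ : Fin n, Fin n) × (Fin 2 × Fin 2) → Finset (Fin 3 × Fin n) :=
    fun s => colEdge s.2.1 s.1.2 ∪ colEdge s.2.2 s.1.1
  have hS : ∀ s, s ∈ S ↔ 0 < s.1.2 ∧ s.1.2 < s.1.1 := fun s => by simp [S]
  have hpos : ∀ i : Fin n, 0 < i ↔ 0 < (i : ℕ) := fun i => by rw [Fin.lt_def]; simp
  have hAB : criticalSets n = A ∪ S.image f := by
    ext τ
    rw [mem_criticalSets, Finset.mem_union, Finset.mem_image, Finset.mem_image]
    constructor
    · intro h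
      rcases h.eq_fullColumn_or with ⟨j, hj, rfl⟩ | ⟨i, j, k, l, hi, hij, rfl⟩
      · exact Or.inl ⟨j, Finset.mem_Ioi.2 ((hpos j).2 hj), rfl⟩
      · exact Or.inr ⟨⟨⟨j, i⟩, k, l⟩, (hS _).2 ⟨(hpos i).2 hi, hij⟩, rfl⟩
    · rintro (⟨j, hj, rfl⟩ | ⟨s, hs, rfl⟩)
      · exact isCritical_fullColumn ((hpos j).1 (Finset.mem_Ioi.1 hj))
      · obtain ⟨h1, h2⟩ := (hS s).1 hs
        exact isCritical_colEdge_union ((hpos _).1 h1) h2 _ _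
  have hdisj : Disjoint A (S.image f) := by
    rw [Finset.disjoint_left]
    intro τ h1 h2
    obtain ⟨j, -, rfl⟩ := Finset.mem_image.1 h1
    obtain ⟨s, hs, h⟩ := Finset.mem_image.1 h2
    exact fullColumn_ne ((hS s).1 hs).2 h.symm
  have hinj : Set.InjOn f S := by
    rintro ⟨⟨j, i⟩, k, l⟩ hs ⟨⟨j', i'⟩, k', l'⟩ hs' h
    obtain ⟨rfl, rfl, rfl, rfl⟩ := colEdge_union_injective ((hS _).1 hs).2 ((hS _).1 hs').2 h
    rfl
  have hsum : ∑ j : Fin n, (Finset.Ioo 0 j).card = (n - 1).choose 2 := by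
    rw [← sum_pred_fin]
    refine Finset.sum_congr rfl fun j _ => ?_
    rw [Fin.card_Ioo]
    simp
  have h2 : 2 * n - 2 = 2 * (n - 1) := by omega
  rw [hAB, Finset.card_union_of_disjoint hdisj, Finset.card_image_of_injective _
    fullColumn_injective, Finset.card_image_of_injOn hinj, Fin.card_Ioi, Finset.card_product,
    Finset.card_sigma, hsum, h2, ← choose_two_double]
  simp [mul_comm]

theorem IsCritical.card_eq {n : ℕ} [NeZero n] {τ : Finset (Fin 3 × Fin n)} (hτ : IsCritical τ) :
    τ.card = 4 := by
  rcases hτ.eq_fullColumn_or with ⟨j, hj, rfl⟩ | ⟨i, j, k, l, -, hij, rfl⟩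
  · have h : leftNbr ((2 : Fin 3), j) ≠ (2, j) := by
      rw [Ne, gridVertex_ext_iff, leftNbr_snd]
      simp only
      omega
    have h0 : ∀ r : Fin 3, r ≠ 2 → leftNbr ((2 : Fin 3), j) ≠ (r, j) := by
      intro r hr h
      exact hr (congrArg Prod.fst h).symm
    rw [fullColumn, Finset.card_insert_of_notMem, Finset.card_insert_of_notMem,
      Finset.card_insert_of_notMem, Finset.card_singleton]
    · simpa using h.symm
    · simpa using (h0 1 (by decide)).symm
    · simpa using (h0 0 (by decide)).symm
  · have hdis : Disjoint (colEdge k i) (colEdge l j) := by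
      rw [Finset.disjoint_left]
      intro v h1 h2
      rw [mem_colEdge] at h1 h2
      have := Fin.lt_def.1 hij
      omega
    have hcard : ∀ (k : Fin 2) (i : Fin n), (colEdge k i).card = 2 := by
      intro k i
      refine Finset.card_pair fun h => ?_
      rw [gridVertex_ext_iff, Fin.val_castSucc, Fin.val_succ] at h
      omega
    rw [Finset.card_union_of_disjoint hdis, hcard, hcard]

/-! ### The homotopy type -/

theorem compl_insert_injective {n : ℕ} [NeZero n] {τ τ' : Finset (Fin 3 × Fin n)}
    (hτ : gridCorner n ∉ τ) (hτ' : gridCorner n ∉ τ')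
    (h : (insert (gridCorner n) τ)ᶜ = (insert (gridCorner n) τ')ᶜ) : τ = τ' := by
  rw [compl_inj_iff] at h
  rw [← Finset.erase_insert hτ, h, Finset.erase_insert hτ']

/-- The faces outside the star of the corner are the complements of the sets `insert v₀ τ` with
`OffStar τ`. -/
theorem OffStar.of_face {n : ℕ} [NeZero n] {θ : Finset (Fin 3 × Fin n)}
    (hθ : θ ∈ (totalCutComplex (gridGraph 3 n) 3).faces)
    (hs : insert (gridCorner n) θ ∉ (totalCutComplex (gridGraph 3 n) 3).faces) :
    OffStar (θᶜ.erase (gridCorner n)) ∧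
      (insert (gridCorner n) (θᶜ.erase (gridCorner n)))ᶜ = θ := by
  have hv : gridCorner n ∈ θᶜ := by
    rw [Finset.mem_compl]
    intro h
    exact hs (by rwa [Finset.insert_eq_of_mem h])
  have hins : insert (gridCorner n) (θᶜ.erase (gridCorner n)) = θᶜ := Finset.insert_erase hv
  refine ⟨⟨Finset.notMem_erase _ _, fun h => hs ?_, ?_⟩, ?_⟩
  · rw [mem_totalCutComplex_iff, Finset.compl_insert]
    exact ⟨Finset.insert_nonempty _ _, h⟩
  · rw [hins]
    exact ((mem_totalCutComplex_iff θ).1 hθ).2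
  · rw [hins, compl_compl]

theorem OffStar.card_le {n : ℕ} [NeZero n] {τ : Finset (Fin 3 × Fin n)} (hτ : OffStar τ) :
    τ.card ≤ 4 := by
  by_contra h
  exact hτ.not_indep (hasIndepTriple_of_card (by omega))

theorem card_compl_insert_corner {n : ℕ} [NeZero n] {τ : Finset (Fin 3 × Fin n)}
    (hτ : gridCorner n ∉ τ) : (insert (gridCorner n) τ)ᶜ.card = 3 * n - (τ.card + 1) := by
  rw [Finset.card_compl, Finset.card_insert_of_notMem hτ]
  simp

theorem OffStar.face {n : ℕ} [NeZero n] (hn : 2 ≤ n) {τ : Finset (Fin 3 × Fin n)}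
    (hτ : OffStar τ) :
    (insert (gridCorner n) τ)ᶜ ∈ (totalCutComplex (gridGraph 3 n) 3).faces := by
  rw [mem_totalCutComplex_iff, compl_compl]
  refine ⟨?_, hτ.indep⟩
  rw [← Finset.card_pos, card_compl_insert_corner hτ.corner_notMem]
  have := hτ.card_le
  omega

theorem OffStar.insert_corner_notMem {n : ℕ} [NeZero n] {τ : Finset (Fin 3 × Fin n)}
    (hτ : OffStar τ) : insert (gridCorner n) (insert (gridCorner n) τ)ᶜ ∉
      (totalCutComplex (gridGraph 3 n) 3).faces := by
  have h : insert (gridCorner n) (insert (gridCorner n) τ)ᶜ = τᶜ := by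
    rw [← Finset.compl_erase, Finset.erase_insert hτ.corner_notMem]
  rw [mem_totalCutComplex_iff, h, compl_compl]
  exact fun h => hτ.not_indep h.2

/-- The star of the corner together with the critical faces. -/
def morseComplex (n : ℕ) [NeZero n] : PreAbstractSimplicialComplex (Fin 3 × Fin n) where
  faces := {θ | θ ∈ (totalCutComplex (gridGraph 3 n) 3).faces ∧
    (insert (gridCorner n) θ ∈ (totalCutComplex (gridGraph 3 n) 3).faces ∨
      ∃ τ, IsCritical τ ∧ θ = (insert (gridCorner n) τ)ᶜ)}
  isRelLowerSet_faces := by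
    rintro θ ⟨hθ, h⟩
    refine ⟨((totalCutComplex _ 3).isRelLowerSet_faces hθ).1, fun θ' hle hne =>
      ⟨((totalCutComplex _ 3).isRelLowerSet_faces hθ).2 hle hne, ?_⟩⟩
    have hstar : insert (gridCorner n) θ ∈ (totalCutComplex (gridGraph 3 n) 3).faces →
        insert (gridCorner n) θ' ∈ (totalCutComplex (gridGraph 3 n) 3).faces := fun h =>
      ((totalCutComplex _ 3).isRelLowerSet_faces h).2 (Finset.insert_subset_insert _ hle)
        (Finset.insert_nonempty _ _)
    rcases h with h | ⟨τ, hτ, rfl⟩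
    · exact Or.inl (hstar h)
    · rcases eq_or_ne θ' (insert (gridCorner n) τ)ᶜ with rfl | hne'
      · exact Or.inr ⟨τ, hτ, rfl⟩
      · -- The complement of `insert v₀ θ'` has at least five elements.
        left
        have hss : τ ⊂ (insert (gridCorner n) θ')ᶜ := by
          obtain ⟨v, hv, hv'⟩ := Finset.exists_of_ssubset (lt_of_le_of_ne hle hne')
          have hv := Finset.mem_compl.1 hv
          refine (Finset.ssubset_iff_of_subset fun w hw => ?_).2 ⟨v, ?_, fun h =>
            hv (Finset.mem_insert_of_mem h)⟩
          · rw [Finset.mem_compl, Finset.mem_insert, not_or]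
            refine ⟨fun h => hτ.1.corner_notMem (h ▸ hw), fun h => ?_⟩
            exact Finset.mem_compl.1 (hle h) (Finset.mem_insert_of_mem hw)
          · rw [Finset.mem_compl, Finset.mem_insert, not_or]
            exact ⟨fun h => hv (h ▸ Finset.mem_insert_self _ _), hv'⟩
        have := Finset.card_lt_card hss
        rw [hτ.card_eq] at this
        rw [mem_totalCutComplex_iff]
        exact ⟨Finset.insert_nonempty _ _, hasIndepTriple_of_card this⟩

/-- The matching collapses the total cut complex onto the star of the corner with the critical
faces. -/
theorem nonempty_homotopyEquiv_morseComplex (n : ℕ) [NeZero n] (hn : 2 ≤ n) :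
    Nonempty (ContinuousMap.HomotopyEquiv
      (geometricRealization (totalCutComplex (gridGraph 3 n) 3))
      (geometricRealization (morseComplex n))) := by
  classical
  -- A matched pair is represented by its larger set, which corresponds to its smaller face.
  let ι := {τ : Finset (Fin 3 × Fin n) // OffStar τ ∧ ∃ p ∈ τ, Toggles τ p}
  choose! p hpτ hpT using fun i : ι => i.2.2
  let ρ : ι → Finset (Fin 3 × Fin n) := fun i => (insert (gridCorner n) i.1)ᶜ
  have hpc : ∀ i, p i ≠ gridCorner n := fun i => i.2.1.toggle_ne_corner (hpT i)
  have hins : ∀ i, insert (p i) (ρ i) = (insert (gridCorner n) (i.1.erase (p i)))ᶜ := by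
    intro i
    have : insert (gridCorner n) (i.1.erase (p i)) = (insert (gridCorner n) i.1).erase (p i) :=
      (Finset.erase_insert_of_ne (hpc i).symm).symm
    rw [this, Finset.compl_erase]
  have herase : ∀ i : ι, OffStar (i.1.erase (p i)) := fun i => i.2.1.erase_toggle (hpT i) (hpτ i)
  have herT : ∀ i : ι, Toggles (i.1.erase (p i)) (p i) := fun i =>
    i.2.1.toggles_congr (hpT i) fun v hv => by simp [hv]
  -- Smaller sets, that is larger faces, are removed first.
  let r : ι → (ℕ ×ₗ ℕ)ᵒᵈ := fun i =>
    OrderDual.toDual (toLex (i.1.card, ∑ v ∈ i.1, gridIndex v))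
  have hlt : ∀ i j : ι, (j.1.card < i.1.card ∨ (j.1.card = i.1.card ∧
      ∑ v ∈ j.1, gridIndex v < ∑ v ∈ i.1, gridIndex v)) → r i < r j := by
    intro i j h
    exact OrderDual.toDual_lt_toDual.2 (Prod.Lex.toLex_lt_toLex.2 h)
  have hcrit : ∀ θ ∈ (totalCutComplex (gridGraph 3 n) 3).faces, θ ∉ (morseComplex n).faces →
      ∃ τ, OffStar τ ∧ θ = (insert (gridCorner n) τ)ᶜ ∧ ∃ q, Toggles τ q := by
    intro θ hθ hθM
    have hs : insert (gridCorner n) θ ∉ (totalCutComplex (gridGraph 3 n) 3).faces :=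
      fun h => hθM ⟨hθ, Or.inl h⟩
    obtain ⟨h1, h2⟩ := OffStar.of_face hθ hs
    refine ⟨_, h1, h2.symm, ?_⟩
    by_contra hcon
    push Not at hcon
    exact hθM ⟨hθ, Or.inr ⟨_, ⟨h1, hcon⟩, h2.symm⟩⟩
  -- A set with a toggled vertex belongs to the pair of `τ` or of `insert q τ`.
  have hpair : ∀ τ, OffStar τ → ∀ q, Toggles τ q → ∃ i : ι, p i = q ∧ i.1 = insert q τ := by
    intro τ hτ q hq
    have h1 := hτ.insert_toggle hq
    have h2 : Toggles (insert q τ) q := hτ.toggles_congr hq fun v hv => by simp [hv]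
    refine ⟨⟨insert q τ, h1, q, Finset.mem_insert_self _ _, h2⟩, ?_, rfl⟩
    exact (hpT _).unique h2
  refine nonempty_homotopyEquiv_of_matching (morseComplex n) ρ p r ?_ ?_ ?_ Finset.univ _ ?_ ?_ ?_
  · exact fun i => ((mem_totalCutComplex_iff _).1 (i.2.1.face hn)).1
  · intro i h
    exact Finset.mem_compl.1 h (Finset.mem_insert_of_mem (hpτ i))
  · rintro i ⟨-, h | ⟨τ, hτ, h⟩⟩
    · exact i.2.1.insert_corner_notMem h
    · have := compl_insert_injective i.2.1.corner_notMem hτ.1.corner_notMem h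
      exact hτ.2 _ (this ▸ hpT i)
  · intro i _ j _ hij
    rw [hins, hins]
    refine ⟨fun h => hij (Subtype.ext (compl_insert_injective i.2.1.corner_notMem
      j.2.1.corner_notMem h)), fun h => ?_, fun h => ?_⟩
    · have h := compl_insert_injective i.2.1.corner_notMem (herase j).corner_notMem h
      have hp : p i = p j := (hpT i).unique (h ▸ herT j)
      have := hpτ i
      rw [h, hp] at this
      exact Finset.notMem_erase _ _ this
    · have h := compl_insert_injective (herase i).corner_notMem (herase j).corner_notMem h
      have hp : p i = p j := (herT i).unique (h ▸ herT j)
      apply hij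
      apply Subtype.ext
      rw [← Finset.insert_erase (hpτ i), h, hp, Finset.insert_erase (hpτ j)]
  · intro θ
    constructor
    · intro hθ
      by_cases hθM : θ ∈ (morseComplex n).faces
      · exact Or.inl hθM
      · obtain ⟨τ, hτ, rfl, q, hq⟩ := hcrit θ hθ hθM
        obtain ⟨i, hpi, hi⟩ := hpair τ hτ q hq
        refine Or.inr ⟨i, Finset.mem_univ _, ?_⟩
        by_cases hqτ : q ∈ τ
        · left
          simp only [ρ, hi, Finset.insert_eq_of_mem hqτ]
        · right
          rw [hins, hi, hpi, Finset.erase_insert hqτ]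
    · rintro (h | ⟨i, -, rfl | rfl⟩)
      · exact h.1
      · exact i.2.1.face hn
      · rw [hins]
        exact (herase i).face hn
  · intro i _ θ hθ hsub
    have hθc : θᶜ ⊆ insert (gridCorner n) i.1 := by
      rw [← compl_compl (insert (gridCorner n) i.1)]
      exact Finset.compl_subset_compl.2 hsub
    have hs : insert (gridCorner n) θ ∉ (totalCutComplex (gridGraph 3 n) 3).faces := by
      intro h
      refine i.2.1.not_indep (((mem_totalCutComplex_iff _).1 h).2.mono fun v hv => ?_)
      rw [Finset.mem_compl, Finset.mem_insert, not_or] at hv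
      exact (Finset.mem_insert.1 (hθc (Finset.mem_compl.2 hv.2))).resolve_left hv.1
    obtain ⟨hτ, hτθ⟩ := OffStar.of_face hθ hs
    set τ := θᶜ.erase (gridCorner n) with hτdef
    have hτi : τ ⊆ i.1 := fun v hv => by
      obtain ⟨h1, h2⟩ := Finset.mem_erase.1 hv
      exact (Finset.mem_insert.1 (hθc h2)).resolve_left h1
    rcases eq_or_ne τ i.1 with heq | hne
    · exact Or.inl (by rw [← hτθ, heq])
    rcases eq_or_ne τ (i.1.erase (p i)) with heq | hne'
    · exact Or.inr (Or.inl (by rw [← hτθ, hins, heq]))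
    have hcard : τ.card < i.1.card := Finset.card_lt_card (lt_of_le_of_ne hτi hne)
    obtain ⟨q, hq⟩ : ∃ q, Toggles τ q := by
      by_contra hcon
      push Not at hcon
      have h4 : τ.card = 4 := IsCritical.card_eq ⟨hτ, hcon⟩
      have := i.2.1.card_le
      omega
    obtain ⟨j, hpj, hj⟩ := hpair τ hτ q hq
    refine Or.inr (Or.inr ⟨j, Finset.mem_univ _, ?_, hlt i j ?_⟩)
    · by_cases hqτ : q ∈ τ
      · left
        simp only [ρ, hj, Finset.insert_eq_of_mem hqτ, hτθ]
      · right
        rw [hins, hj, hpj, Finset.erase_insert hqτ, hτθ]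
    · by_cases hqτ : q ∈ τ
      · rw [hj, Finset.insert_eq_of_mem hqτ]
        exact Or.inl hcard
      · rw [hj, Finset.card_insert_of_notMem hqτ]
        by_cases hc : τ.card + 1 < i.1.card
        · exact Or.inl hc
        · refine Or.inr ⟨by omega, ?_⟩
          obtain ⟨x, hx, hxτ⟩ := Finset.exists_of_ssubset (lt_of_le_of_ne hτi hne)
          have hτx : τ = i.1.erase x := by
            refine Finset.eq_of_subset_of_card_le (fun v hv => Finset.mem_erase.2
              ⟨fun h => hxτ (h ▸ hv), hτi hv⟩) ?_
            rw [Finset.card_erase_of_mem hx]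
            omega
          have hxp : x ≠ p i := fun h => hne' (h ▸ hτx)
          have hidx := i.2.1.gridIndex_lt (hpT i) (hpτ i) hx hxp (hτx ▸ hτ) (hτx ▸ hq) (hτx ▸ hqτ)
          rw [Finset.sum_insert hqτ, ← Finset.add_sum_erase i.1 _ hx, ← hτx]
          omega

theorem theorem4p2 (n : ℕ) (hn : 2 ≤ n) :
    Nonempty (ContinuousMap.HomotopyEquiv
      (geometricRealization (totalCutComplex (gridGraph 3 n) 3))
      (WedgeOfSpheres ((2 * n - 2).choose 2) (3 * n - 6))) := by
  have : NeZero n := ⟨by omega⟩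
  obtain ⟨h1⟩ := nonempty_homotopyEquiv_morseComplex n hn
  let τ : Fin ((2 * n - 2).choose 2) ≃ criticalSets n :=
    ((criticalSets n).equivFinOfCardEq (card_criticalSets n)).symm
  have hτ : ∀ i, IsCritical (τ i).1 := fun i => mem_criticalSets.1 (τ i).2
  have hcard : ∀ i, ((insert (gridCorner n) (τ i).1)ᶜ).card = 3 * n - 6 + 1 := by
    intro i
    rw [card_compl_insert_corner (hτ i).1.corner_notMem, (hτ i).card_eq]
    omega
  let e : Fin ((2 * n - 2).choose 2) → Fin (3 * n - 6 + 1) ↪ Fin 3 × Fin n := fun i =>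
    (Finset.equivFinOfCardEq (hcard i)).symm.toEmbedding.trans (Function.Embedding.subtype _)
  have he : ∀ i, Finset.univ.map (e i) = (insert (gridCorner n) (τ i).1)ᶜ := by
    intro i
    rw [← Finset.map_map, Finset.map_univ_equiv, Finset.univ_eq_attach, Finset.attach_map_val]
  have hlarge : ∀ θ : Finset (Fin 3 × Fin n), θ.Nonempty → gridCorner n ∈ θ → 5 ≤ θᶜ.card →
      θ ∈ (morseComplex n).faces := by
    intro θ hne hc h5
    have : θ ∈ (totalCutComplex (gridGraph 3 n) 3).faces :=
      (mem_totalCutComplex_iff θ).2 ⟨hne, hasIndepTriple_of_card h5⟩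
    exact ⟨this, Or.inl (by rwa [Finset.insert_eq_of_mem hc])⟩
  obtain ⟨h2⟩ := nonempty_homotopyEquiv_wedgeOfSpheres (morseComplex n) (gridCorner n) e
    (by
      refine hlarge _ (Finset.singleton_nonempty _) (Finset.mem_singleton_self _) ?_
      rw [Finset.card_compl, Finset.card_singleton]
      simp
      omega)
    (by
      intro i j hij
      rw [he, he] at hij
      exact τ.injective (Subtype.ext (compl_insert_injective (hτ i).1.corner_notMem
        (hτ j).1.corner_notMem hij)))
    (by
      rintro i ⟨h, -⟩
      rw [he] at h
      exact (hτ i).1.insert_corner_notMem h)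
    (by
      rintro θ ⟨hθ, h | ⟨σ, hσ, rfl⟩⟩
      · exact Or.inl ⟨h, Or.inl (by rwa [Finset.insert_idem])⟩
      · refine Or.inr ⟨τ.symm ⟨σ, mem_criticalSets.2 hσ⟩, ?_⟩
        rw [he, Equiv.apply_symm_apply])
    (by
      intro i
      rw [he]
      exact ⟨(hτ i).1.face hn, Or.inr ⟨_, hτ i, rfl⟩⟩)
    (by
      intro i θ hθ
      have h1 := Finset.card_lt_card hθ
      rw [Finset.card_map, Finset.card_univ, Fintype.card_fin] at h1
      have h2 := Finset.card_insert_le (gridCorner n) θ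
      refine hlarge _ (Finset.insert_nonempty _ _) (Finset.mem_insert_self _ _) ?_
      rw [Finset.card_compl, Fintype.card_prod, Fintype.card_fin, Fintype.card_fin]
      omega)
  exact ⟨h1.trans h2⟩
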